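/- Let $D$ be a diagram on $\mathbb S^2$ of a knot in $\mathbb S^3$. Let $C(D)$ be its number of crossings, and let $P\subset\mathbb S^2$ be the immersed circle obtained from $D$ by forgetting the crossing information. Let $N(P)$ be a regular neighbourhood of $P$ in $\mathbb S^2$: a closed neighbourhood of $P$ obtained by removing from each connected component of $\mathbb S^2\setminus P$ one open disk whose closure is a closed disk contained in that component. Let $\mathcal R$ be the set of connected components of $\mathbb S^2\setminus N(P)$. For $S\subset\mathcal R$ let $F(S)=\mathbb S^2\setminus\bigcup_{R\in S}R$, and let $c(D,S)$ be the minimum of $C(E)$ over all diagrams $E$ on $F(S)$ obtained from $D$ by Reidemeister moves (and ambient isotopies) performed on $F(S)$. Let $c_{\max}(D,n)$ be the maximum of $c(D,S)$ over all $S\subset\mathcal R$ with $|S|=n$. Theorem 1.6. If $D$ is a diagram of a trivial knot and $C(D)>0$, then for every choice of the regular neighbourhood $N(P)$ we have $c_{\max}(D,2)>0$. That is, there are two regions $U,V\in\mathcal R$ such that no crossingless diagram can be obtained from $D$ by Reidemeister moves and ambient isotopies on $F(\{U,V\})$. -/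

import Mathlib

open scoped ContDiff

noncomputable section

namespace PuncturedKnot

/-- The 2-sphere, on which diagrams are drawn. -/
abbrev S2 : Type := Metric.sphere (0 : EuclideanSpace ℝ (Fin 3)) 1

/-- The 3-sphere, in which knots live. The 2-sphere sits in it as the equator `x 3 = 0`. -/
abbrev S3 : Type := Metric.sphere (0 : EuclideanSpace ℝ (Fin 4)) 1

/-- The circle `ℝ / ℤ`, the source of all closed curves. -/
abbrev S1 : Type := UnitAddCircle

/-! ### Knots in the 3-sphere -/

/-- A (smooth, parametrized) knot in the 3-sphere: a smooth embedding of the circle. -/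
structure Knot where
  /-- the underlying closed curve -/
  curve : S1 → S3
  smooth : ContDiff ℝ ∞ (fun t : ℝ => (curve (t : S1) : EuclideanSpace ℝ (Fin 4)))
  immersed : ∀ t : ℝ,
    deriv (fun t : ℝ => (curve (t : S1) : EuclideanSpace ℝ (Fin 4))) t ≠ 0
  injective : Function.Injective curve

/-- An ambient isotopy of a topological space `X`: a continuous family `H (t, ·)`, `t ∈ [0, 1]`,
of self-homeomorphisms of `X` that starts at the identity. -/
structure AmbientIsotopy (X : Type*) [TopologicalSpace X] where
  /-- the family of maps -/
  map : C(unitInterval × X, X)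
  map_zero : ∀ x, map (0, x) = x
  homeo : ∀ t, IsHomeomorph (fun x => map (t, x))

/-- A knot is trivial if an ambient isotopy of the 3-sphere carries it onto a great circle. -/
def Knot.IsTrivial (K : Knot) : Prop :=
  ∃ H : AmbientIsotopy S3, (fun x => H.map (1, x)) '' Set.range K.curve =
    {x : S3 | x.1 2 = 0 ∧ x.1 3 = 0}

/-! ### Diagrams on the 2-sphere -/

/-- A knot diagram on the 2-sphere: a generic immersion of the circle (a smooth immersion whose
only multiple points are finitely many transverse double points), with over/under information at
every double point. -/
structure Diagram where
  /-- the underlying closed curve -/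
  curve : S1 → S2
  smooth : ContDiff ℝ ∞ (fun t : ℝ => (curve (t : S1) : EuclideanSpace ℝ (Fin 3)))
  immersed : ∀ t : ℝ,
    deriv (fun t : ℝ => (curve (t : S1) : EuclideanSpace ℝ (Fin 3))) t ≠ 0
  no_triple : ∀ s t u : S1, s ≠ t → t ≠ u → s ≠ u → curve s = curve t → curve t ≠ curve u
  transverse : ∀ s t : ℝ, (s : S1) ≠ (t : S1) → curve s = curve t →
    LinearIndependent ℝ
      ![deriv (fun t : ℝ => (curve (t : S1) : EuclideanSpace ℝ (Fin 3))) s,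
        deriv (fun t : ℝ => (curve (t : S1) : EuclideanSpace ℝ (Fin 3))) t]
  finite_crossings : {p : S2 | ∃ s t : S1, s ≠ t ∧ curve s = p ∧ curve t = p}.Finite
  /-- the parameters at which the curve runs on the over strand of a crossing -/
  overStrand : Set S1
  over_crossing : ∀ s ∈ overStrand, ∃ t, s ≠ t ∧ curve s = curve t
  over_iff : ∀ s t, s ≠ t → curve s = curve t → (s ∈ overStrand ↔ t ∉ overStrand)

/-- The immersed circle `P(D)` on the sphere. -/
def Diagram.image (D : Diagram) : Set S2 := Set.range D.curve

/-- The set of crossing points of a diagram. -/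
def Diagram.crossings (D : Diagram) : Set S2 :=
  {p : S2 | ∃ s t : S1, s ≠ t ∧ D.curve s = p ∧ D.curve t = p}

/-- The number `C(D)` of crossing points. -/
def Diagram.crossingNumber (D : Diagram) : ℕ := D.crossings.ncard

/-- `D` is a diagram of the knot `K`: the knot avoids the two poles `(0, 0, 0, ±1)` of the
3-sphere, its projection to the equatorial 2-sphere along the meridians is the curve of `D`, and
at each crossing the over strand is the one with the larger last coordinate. -/
def Diagram.IsDiagramOf (D : Diagram) (K : Knot) : Prop :=
  (∀ t : S1, ∃ c : ℝ, 0 < c ∧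
    ∀ i : Fin 3, (K.curve t).1 i.castSucc = c * (D.curve t).1 i) ∧
  ∀ s t : S1, s ≠ t → D.curve s = D.curve t → s ∈ D.overStrand →
    (K.curve t).1 3 < (K.curve s).1 3

/-! ### Reidemeister moves on a subsurface of the sphere -/

/-- `Δ` is a closed disk in the sphere, `U` being the corresponding open disk. -/
def IsDiskPair (U Δ : Set S2) : Prop :=
  ∃ h : ℂ → S2, ContinuousOn h (Metric.closedBall 0 1) ∧
    Set.InjOn h (Metric.closedBall 0 1) ∧
    h '' Metric.ball 0 1 = U ∧ h '' Metric.closedBall 0 1 = Δ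

/-- A closed arc of the circle. -/
def closedArc (a b : ℝ) : Set S1 := (fun t : ℝ => (t : S1)) '' Set.Icc a b

/-- The interior of a closed arc of the circle. -/
def openArc (a b : ℝ) : Set S1 := (fun t : ℝ => (t : S1)) '' Set.Ioo a b

/-- `D` meets the closed disk `Δ` (with interior `U`) exactly in the `k` arcs parametrized by the
intervals `[a j, b j]`. Each of them runs in the interior of `Δ` except for its two endpoints,
which lie on the boundary, and there is no crossing on the boundary. -/
def Diagram.MeetsInArcs (D : Diagram) (U Δ : Set S2) {k : ℕ} (a b : Fin k → ℝ) : Prop :=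
  (∀ t, D.curve t ∈ Δ ↔ ∃ j, t ∈ closedArc (a j) (b j)) ∧
  (∀ t, D.curve t ∈ U ↔ ∃ j, t ∈ openArc (a j) (b j)) ∧
  D.crossings ∩ Δ ⊆ U

/-- `D` and `E` are diagrams on `F` that coincide, crossing information included, outside the
interior `U` of the closed disk `Δ ⊆ F`, and both meet `Δ` in `k` arcs with the same endpoints,
parametrized by the same disjoint intervals. -/
structure DifferInDisk (F U Δ : Set S2) {k : ℕ} (a b : Fin k → ℝ) (D E : Diagram) : Prop where
  disk : IsDiskPair U Δ
  disk_subset : Δ ⊆ F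
  left_subset : D.image ⊆ F
  right_subset : E.image ⊆ F
  arc_lt : ∀ j, a j < b j
  arc_lt_one : ∀ j, b j < a j + 1
  arcs_disjoint : ∀ i j, i ≠ j → Disjoint (closedArc (a i) (b i)) (closedArc (a j) (b j))
  left_arcs : D.MeetsInArcs U Δ a b
  right_arcs : E.MeetsInArcs U Δ a b
  curve_eq : ∀ t, (∀ j, t ∉ openArc (a j) (b j)) → D.curve t = E.curve t
  over_iff : ∀ t, (∀ j, t ∉ openArc (a j) (b j)) → (t ∈ D.overStrand ↔ t ∈ E.overStrand)

/-- The point `p` is a crossing of `D` at which the arc `A` passes over the (disjoint) arc `B`. -/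
def Diagram.CrossesOver (D : Diagram) (A B : Set S1) (p : S2) : Prop :=
  ∃ s ∈ A, ∃ t ∈ B, D.curve s = p ∧ D.curve t = p ∧ s ∈ D.overStrand

/-- First Reidemeister move on `F`, creating a crossing: a proper arc of a disk without crossings
is replaced by a proper arc with the same endpoints and exactly one (transverse) self-crossing,
that is, by an arc with one kink, to either side and with either crossing information. -/
def ReidemeisterOne (F : Set S2) (D E : Diagram) : Prop :=
  ∃ (U Δ : Set S2) (a b : Fin 1 → ℝ), DifferInDisk F U Δ a b D E ∧
    D.crossings ∩ Δ = ∅ ∧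
    ∃ p, E.crossings ∩ Δ = {p}

/-- Second Reidemeister move on `F`, creating two crossings: two disjoint proper arcs of a disk
are replaced by two simple proper arcs with the same endpoints that cross each other exactly
twice, the first one passing over the second at both crossings. (The two arcs then cobound a
bigon, because their endpoints are unlinked on the boundary of the disk.) -/
def ReidemeisterTwo (F : Set S2) (D E : Diagram) : Prop :=
  ∃ (U Δ : Set S2) (a b : Fin 2 → ℝ), DifferInDisk F U Δ a b D E ∧
    D.crossings ∩ Δ = ∅ ∧
    ∃ p q, p ≠ q ∧ E.crossings ∩ Δ = {p, q} ∧
      E.CrossesOver (closedArc (a 0) (b 0)) (closedArc (a 1) (b 1)) p ∧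
      E.CrossesOver (closedArc (a 0) (b 0)) (closedArc (a 1) (b 1)) q

/-- Inside `Δ` the diagram consists of three simple arcs, any two of which cross exactly once,
the first (top) passing over the second (middle) and the third (bottom), and the second over the
third. The three crossings are distinct because a diagram has no triple points. -/
def Diagram.IsTriangleTangle (D : Diagram) (Δ : Set S2) (a b : Fin 3 → ℝ) : Prop :=
  ∃ p q r, D.crossings ∩ Δ = {p, q, r} ∧
    D.CrossesOver (closedArc (a 0) (b 0)) (closedArc (a 1) (b 1)) p ∧
    D.CrossesOver (closedArc (a 0) (b 0)) (closedArc (a 2) (b 2)) q ∧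
    D.CrossesOver (closedArc (a 1) (b 1)) (closedArc (a 2) (b 2)) r

/-- Third Reidemeister move on `F`: three arcs of a disk that cross pairwise once are replaced by
three such arcs with the same endpoints and the same heights. Up to isotopy of the disk fixing
its boundary, there are exactly two such configurations; they differ by the sliding of one arc
across the crossing of the other two. -/
def ReidemeisterThree (F : Set S2) (D E : Diagram) : Prop :=
  ∃ (U Δ : Set S2) (a b : Fin 3 → ℝ), DifferInDisk F U Δ a b D E ∧
    D.IsTriangleTangle Δ a b ∧ E.IsTriangleTangle Δ a b

/-- `D` and `E` are diagrams on `F`, and an ambient isotopy of `F` carries `D` to `E`, with its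
crossing information, up to the parametrization `ρ` of the curves. -/
def IsotopicOn (F : Set S2) (D E : Diagram) : Prop :=
  D.image ⊆ F ∧ E.image ⊆ F ∧
  ∃ (H : AmbientIsotopy F) (ρ : S1 ≃ₜ S1),
    (∀ (t : S1) (ht : D.curve t ∈ F), E.curve (ρ t) = (H.map (1, ⟨D.curve t, ht⟩) : S2)) ∧
    ∀ t : S1, ρ t ∈ E.overStrand ↔ t ∈ D.overStrand

/-- One step of a deformation of diagrams on `F`: an isotopy of `F` or a Reidemeister move. -/
def Step (F : Set S2) (D E : Diagram) : Prop :=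
  IsotopicOn F D E ∨ ReidemeisterOne F D E ∨ ReidemeisterTwo F D E ∨ ReidemeisterThree F D E

/-- `E` is obtained from `D` by finitely many Reidemeister moves, in either direction, and
isotopies performed on `F`. -/
def ReidemeisterEquivalent (F : Set S2) : Diagram → Diagram → Prop :=
  Relation.EqvGen (Step F)

/-! ### Regular neighbourhoods, complementary regions and `c_max` -/

/-- The set of connected components of a subset of the sphere. -/
def components (X : Set S2) : Set (Set S2) := {U | ∃ x ∈ X, U = connectedComponentIn X x}

/-- `N` is a regular neighbourhood of the immersed circle `P`: a closed neighbourhood obtained by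
removing from each connected component of the complement of `P` exactly one open disk, the
closure of which is a closed disk contained in that component. -/
structure IsRegularNeighbourhood (N P : Set S2) : Prop where
  isClosed : IsClosed N
  subset_interior : P ⊆ interior N
  disks : ∀ U ∈ components Nᶜ, IsDiskPair U (closure U)
  unique_disk : ∀ u ∈ components Pᶜ, ∃! U, U ∈ components Nᶜ ∧ U ⊆ u

/-- The set `𝓡` of regions: the connected components of the complement of `N = N(P)`. -/
def regions (N : Set S2) : Set (Set S2) := components Nᶜ

/-- The punctured sphere `F(S)`, obtained by removing the regions that belong to `S`. -/
def puncturedSphere (S : Set (Set S2)) : Set S2 := (⋃₀ S)ᶜ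

/-- `c(D, S)`: the minimal number of crossings of a diagram on `F(S)` obtained from `D` by
Reidemeister moves performed on `F(S)`. -/
def minCrossings (D : Diagram) (S : Set (Set S2)) : ℕ :=
  sInf {m | ∃ E : Diagram, E.image ⊆ puncturedSphere S ∧
    ReidemeisterEquivalent (puncturedSphere S) D E ∧ m = E.crossingNumber}

/-- `c_max(D, n)`: the maximum of `c(D, S)` over all sets `S` of exactly `n` regions, where the
regions are those of the regular neighbourhood `N` of `P(D)`. -/
def cMax (D : Diagram) (N : Set S2) (n : ℕ) : ℕ :=
  sSup {m | ∃ S : Set (Set S2), S ⊆ regions N ∧ S.encard = n ∧ m = minCrossings D S}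

end PuncturedKnot

end

/-!
Around a crossing the regions of the complement of the immersed circle `P` are numbered by their
winding numbers (the Alexander numbering), and two opposite corners, those to the left of both
strands and to the right of both strands, have numbers that differ by two. So the diagram winds
twice around the annulus that is left when the two regions in these corners are removed
(`Diagram.exists_hasWinding_two`, `Diagram.exists_components`). Isotopies and Reidemeister moves
on the annulus are homotopies of the curve there, so they keep the absolute value of the winding
number (`ReidemeisterEquivalent.exists_natAbs_winding_iff`). A diagram without crossings is a
simple closed curve, and such a curve winds at most once around an annulus
(`HasWinding.natAbs_le_one`). Hence no crossingless diagram can be reached, whichever knot is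
represented by the diagram.

Winding numbers are defined by continuous logarithms. The annulus between two points of the sphere
is mapped into `ℂ \ {0}` by the Möbius map `z ↦ (z - a) / (z - c)` in a stereographic coordinate
(`annulusMap`). The pole of the coordinate is taken on the diagram, so that all regions lie in the
coordinate plane. If `a` and `c` are on both sides of a crossing, on a line that both strands
traverse to the same side, then the image of the diagram meets the negative real axis only at the
two passages through the crossing, in the same direction; so it winds twice around the origin
(`HasWinding.eq_two`).
-/

namespace PuncturedKnot

/-! ### Logarithms and winding numbers -/

theorem exists_continuous_log {A : Type*} [TopologicalSpace A] [SimplyConnectedSpace A]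
    [LocallyPathConnectedSpace A] {g : A → ℂ} (hg : Continuous g) (h0 : ∀ x, g x ≠ 0) :
    ∃ L : A → ℂ, Continuous L ∧ ∀ x, Complex.exp (L x) = g x := by
  obtain ⟨a⟩ : Nonempty A := inferInstance
  obtain ⟨F, ⟨-, hF⟩, -⟩ := Complex.isCoveringMapOn_exp.existsUnique_continuousMap_lifts
    ⟨g, hg⟩ (a₀ := a) (e₀ := Complex.log (g a)) (by simp [Complex.exp_log (h0 a)])
    (fun x => by simpa using h0 x)
  exact ⟨F, F.continuous, fun x => congrFun hF x⟩

/-- Two continuous logarithms of the same function on a preconnected set differ by a constant. -/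
theorem log_sub_log_eq {A : Type*} [TopologicalSpace A] {s : Set A} (hs : IsPreconnected s)
    {L M : A → ℂ} (hL : ContinuousOn L s) (hM : ContinuousOn M s)
    (h : ∀ x ∈ s, Complex.exp (L x) = Complex.exp (M x)) {x y : A} (hx : x ∈ s) (hy : y ∈ s) :
    L x - M x = L y - M y := by
  have hpi : (2 * Real.pi * Complex.I : ℂ) ≠ 0 := Complex.two_pi_I_ne_zero
  have key : ∀ z ∈ s, ∃ n : ℤ, L z - M z = n * (2 * Real.pi * Complex.I) := fun z hz => by
    obtain ⟨n, hn⟩ := Complex.exp_eq_exp_iff_exists_int.1 (h z hz)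
    exact ⟨n, by rw [hn]; ring⟩
  have hc : ContinuousOn (fun z => ((L z - M z) / (2 * Real.pi * Complex.I)).re) s :=
    Complex.continuous_re.comp_continuousOn ((hL.sub hM).div_const _)
  have hmaps : Set.MapsTo (fun z => ((L z - M z) / (2 * Real.pi * Complex.I)).re) s
      (Set.range ((↑) : ℤ → ℝ)) := fun z hz => by
    obtain ⟨n, hn⟩ := key z hz
    exact ⟨n, by simp [hn, hpi]⟩
  have hdisc : IsDiscrete (Set.range ((↑) : ℤ → ℝ)) := by
    exact Int.isClosedEmbedding_coe_real.isEmbedding.isDiscrete_range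
  obtain ⟨m, hm⟩ := key x hx
  obtain ⟨n, hn⟩ := key y hy
  have e := hs.constant_of_mapsTo hdisc hc hmaps hx hy
  simp only [hm, hn, mul_div_assoc, div_self hpi, mul_one, Complex.intCast_re] at e
  rw [hm, hn, Int.cast_injective (α := ℝ) e]

/-- `g` has winding number `n` around the origin: it has a continuous logarithm along the real
line that grows by `2πin` over a period. In particular `g` has no zeros. -/
def HasWinding (g : S1 → ℂ) (n : ℤ) : Prop :=
  ∃ L : ℝ → ℂ, Continuous L ∧ (∀ t : ℝ, Complex.exp (L t) = g t) ∧
    ∀ t, L (t + 1) = L t + 2 * Real.pi * Complex.I * n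

theorem coe_add_one (t : ℝ) : ((t + 1 : ℝ) : S1) = t := by
  rw [AddCircle.coe_add, AddCircle.coe_period, add_zero]

theorem continuous_of_comp_coe {X : Type*} [TopologicalSpace X] {f : S1 → X}
    (hf : Continuous fun t : ℝ => f t) : Continuous f :=
  (QuotientAddGroup.isQuotientMap_mk (N := AddSubgroup.zmultiples (1 : ℝ))).continuous_iff.2 hf

theorem hasWinding_exists {g : S1 → ℂ} (hg : Continuous g) (h0 : ∀ x, g x ≠ 0) :
    ∃ n, HasWinding g n := by
  obtain ⟨L, hL, he⟩ := exists_continuous_log (g := fun t : ℝ => g t)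
    (hg.comp (AddCircle.continuous_mk' 1)) (fun _ => h0 _)
  have hper : ∀ t, Complex.exp (L (t + 1)) = Complex.exp (L t) := fun t => by
    rw [he, he, coe_add_one]
  obtain ⟨n, hn⟩ := Complex.exp_eq_exp_iff_exists_int.1 (hper 0)
  refine ⟨n, L, hL, he, fun t => ?_⟩
  have := log_sub_log_eq isPreconnected_univ (L := fun t => L (t + 1)) (M := L)
    (by fun_prop) (by fun_prop) (fun t _ => hper t) (Set.mem_univ t) (Set.mem_univ 0)
  rw [zero_add] at this
  rw [zero_add] at hn
  linear_combination this + hn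

theorem HasWinding.eq_of_log {g : S1 → ℂ} {n : ℤ} (h : HasWinding g n) {L : ℝ → ℂ}
    (hL : Continuous L) (he : ∀ t : ℝ, Complex.exp (L t) = g t) (t : ℝ) :
    L (t + 1) = L t + 2 * Real.pi * Complex.I * n := by
  obtain ⟨M, hM, hMe, hMn⟩ := h
  have := log_sub_log_eq isPreconnected_univ hL.continuousOn hM.continuousOn
    (fun t _ => (he t).trans (hMe t).symm) (Set.mem_univ (t + 1)) (Set.mem_univ t)
  linear_combination this + hMn t

theorem HasWinding.unique {g : S1 → ℂ} {m n : ℤ} (hm : HasWinding g m) (hn : HasWinding g n) :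
    m = n := by
  obtain ⟨L, hL, he, hLm⟩ := hm
  have h := hn.eq_of_log hL he 0
  rw [hLm 0] at h
  have := mul_left_cancel₀ Complex.two_pi_I_ne_zero (add_left_cancel h)
  exact_mod_cast this

theorem HasWinding.ne_zero {g : S1 → ℂ} {n : ℤ} (h : HasWinding g n) (x : S1) : g x ≠ 0 := by
  obtain ⟨L, -, he, -⟩ := h
  induction x using QuotientAddGroup.induction_on with
  | H t => exact he t ▸ Complex.exp_ne_zero _

/-- Multiplication by a function with a logarithm on the circle keeps the winding number. -/
theorem HasWinding.exp_mul {g : S1 → ℂ} {n : ℤ} (h : HasWinding g n) {c : S1 → ℂ}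
    (hc : Continuous c) {g' : S1 → ℂ} (hg' : ∀ x, g' x = Complex.exp (c x) * g x) :
    HasWinding g' n := by
  obtain ⟨L, hL, he, hn⟩ := h
  refine ⟨fun t => c t + L t, (hc.comp (AddCircle.continuous_mk' 1)).add hL, fun t => ?_,
    fun t => ?_⟩
  · rw [Complex.exp_add, he, hg']
  · simp only [hn, coe_add_one]; ring

theorem HasWinding.of_norm_sub_lt {g g' : S1 → ℂ} {n : ℤ} (h : HasWinding g n)
    (hg : Continuous g) (hg' : Continuous g') (hlt : ∀ x, ‖g' x - g x‖ < ‖g x‖) :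
    HasWinding g' n := by
  have hs : ∀ x, g' x / g x ∈ Complex.slitPlane := fun x => by
    have h0 := h.ne_zero x
    have : g' x / g x = 1 + (g' x - g x) / g x := by field_simp; ring
    rw [this]
    apply Complex.mem_slitPlane_of_norm_lt_one
    rw [norm_div, div_lt_one (norm_pos_iff.2 h0)]
    exact hlt x
  refine h.exp_mul (c := fun x => Complex.log (g' x / g x))
    ((hg'.div hg h.ne_zero).clog hs) fun x => ?_
  rw [Complex.exp_log (Complex.slitPlane_ne_zero (hs x)), div_mul_cancel₀ _ (h.ne_zero x)]

/-- Homotopy invariance: the winding number of a continuous family of loops in `ℂ \ {0}` is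
constant when the parameter runs over a preconnected set. -/
theorem HasWinding.of_family {T : Type*} [TopologicalSpace T] {s : Set T}
    (hs : IsPreconnected s) {G : T → S1 → ℂ}
    (hG : ContinuousOn (Function.uncurry G) (s ×ˢ Set.univ)) (h0 : ∀ τ ∈ s, ∀ x, G τ x ≠ 0)
    {σ τ : T} (hσ : σ ∈ s) (hτ : τ ∈ s) {n : ℤ} (h : HasWinding (G σ) n) :
    HasWinding (G τ) n := by
  have := isPreconnected_iff_preconnectedSpace.1 hs
  have hG' : Continuous fun q : s × S1 => G q.1 q.2 :=
    hG.comp_continuous (f := fun q : s × S1 => ((q.1 : T), q.2)) (by fun_prop)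
      (fun q => ⟨q.1.2, trivial⟩)
  have hGc : ∀ a : s, Continuous (G a) := fun a => hG'.comp (Continuous.prodMk_right a)
  have hnear : ∀ a : s, ∀ᶠ b : s in nhds a, ∀ x, ‖G b x - G a x‖ < ‖G a x‖ := fun a => by
    have hopen : IsOpen {q : s × S1 | ‖G q.1 q.2 - G a q.2‖ < ‖G a q.2‖} :=
      isOpen_lt ((hG'.sub ((hGc a).comp continuous_snd)).norm)
        ((hGc a).comp continuous_snd).norm
    obtain ⟨u, v, hu, -, hau, hv, huv⟩ := generalized_tube_lemma (isCompact_singleton (x := a))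
      (isCompact_univ (X := S1)) hopen (by
        rintro ⟨b, x⟩ ⟨rfl, -⟩
        simpa using h0 _ b.2 x)
    filter_upwards [hu.mem_nhds (hau rfl)] with b hb x
    exact huv (Set.mk_mem_prod hb (hv trivial))
  have hlc : IsLocallyConstant fun a : s => HasWinding (G a) n := by
    rw [IsLocallyConstant.iff_eventually_eq]
    intro a
    filter_upwards [hnear a] with b hb
    obtain ⟨m, hm⟩ := hasWinding_exists (hGc a) (h0 a a.2)
    have hm' := hm.of_norm_sub_lt (hGc a) (hGc b) hb
    exact propext ⟨fun H => hm'.unique H ▸ hm, fun H => hm.unique H ▸ hm'⟩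
  exact (hlc.apply_eq_of_preconnectedSpace ⟨σ, hσ⟩ ⟨τ, hτ⟩).mp h

theorem add_int_of_add_one {L : ℝ → ℂ} {c : ℂ} (hL : ∀ t, L (t + 1) = L t + c) (k : ℤ) :
    ∀ t, L (t + k) = L t + c * k := by
  induction k using Int.induction_on with
  | zero => simp
  | succ i ih =>
    intro t
    push_cast at ih ⊢
    rw [← add_assoc, hL, ih]; ring
  | pred i ih =>
    intro t
    have := hL (t + ((-i - 1 : ℤ) : ℝ))
    push_cast at ih this ⊢
    rw [show t + (-(i : ℝ) - 1) + 1 = t + -i by ring, ih] at this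
    linear_combination -this

theorem exists_int_of_coe_eq {s t : ℝ} (h : (s : S1) = t) : ∃ k : ℤ, s = t + k := by
  rw [← sub_eq_zero, ← AddCircle.coe_sub, AddCircle.coe_eq_zero_iff] at h
  obtain ⟨k, hk⟩ := h
  exact ⟨k, by rw [zsmul_one] at hk; linarith⟩

/-- A reparametrization of the loop multiplies the winding number by an integer, the degree of the
reparametrization. For a homeomorphism `ρ`, the use of this for `ρ` and for its inverse shows that
the winding number does not change up to sign. -/
theorem HasWinding.dvd_of_comp {g : S1 → ℂ} {ρ : S1 → S1} (hρ : Continuous ρ) {m n : ℤ}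
    (hm : HasWinding g m) (hn : HasWinding (g ∘ ρ) n) : m ∣ n := by
  have hpi := Complex.two_pi_I_ne_zero
  obtain ⟨d, M, hM, hMe, hMd⟩ := hasWinding_exists
    (g := fun x => (AddCircle.toCircle (ρ x) : ℂ)) (by fun_prop) (fun x => Circle.coe_ne_zero _)
  obtain ⟨L, hL, hLe, hLm⟩ := hm
  -- a lift of `ρ` to the real line
  let r : ℝ → ℝ := fun t => (M t).im / (2 * Real.pi)
  have hr : Continuous r := (Complex.continuous_im.comp hM).div_const _
  have hρr : ∀ t : ℝ, ((r t : ℝ) : S1) = ρ t := fun t => by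
    apply AddCircle.injective_toCircle one_ne_zero
    have h1 : Complex.exp (M t) = (AddCircle.toCircle (ρ t) : ℂ) := hMe t
    have hre : (M t).re = 0 := by
      have := congrArg norm h1
      rwa [Complex.norm_exp, Circle.norm_coe, Real.exp_eq_one_iff] at this
    have hMt : M t = ((2 * Real.pi / 1 * r t : ℝ) : ℂ) * Complex.I := by
      apply Complex.ext
      · simp [hre]
      · simp only [r, Complex.im_ofReal_mul, Complex.I_im, mul_one]
        field_simp
    apply Circle.ext
    rw [← h1, hMt, AddCircle.toCircle_apply_mk, Circle.coe_exp]
  have hrd : ∀ t, r (t + 1) = r t + d := fun t => by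
    simp only [r, hMd, Complex.add_im, Complex.mul_im, Complex.mul_re]
    simp
    field_simp
  have h1 := hn.eq_of_log (L := fun t => L (r t)) (hL.comp hr)
    (fun t => by rw [hLe, hρr]; rfl) 0
  simp only [hrd, add_int_of_add_one hLm] at h1
  refine ⟨d, ?_⟩
  have h2 := add_left_cancel h1
  rw [mul_assoc] at h2
  exact_mod_cast (mul_left_cancel₀ hpi h2).symm

/-! ### Winding numbers of simple loops -/

theorem HasWinding.conj {g : S1 → ℂ} {n : ℤ} (h : HasWinding g n) :
    HasWinding (fun x => (starRingEnd ℂ) (g x)) (-n) := by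
  obtain ⟨L, hL, he, hn⟩ := h
  refine ⟨fun t => (starRingEnd ℂ) (L t), Complex.continuous_conj.comp hL, fun t => ?_,
    fun t => ?_⟩
  · rw [Complex.exp_conj, he]
  · simp [hn, Complex.conj_ofNat]

/-- Along a path in `ℂ \ {0}` from `1` to a negative real number the argument changes by `-π` if
the path stays in the closed lower half plane. -/
theorem im_log_sub_of_im_nonpos {P : ℝ → ℂ} (hP : Continuous P)
    (him : ∀ r, (Complex.exp (P r)).im ≤ 0) {r₀ r₁ : ℝ} (h0 : Complex.exp (P r₀) = 1)
    {q : ℝ} (hq : q < 0) (h1 : Complex.exp (P r₁) = q) : (P r₁ - P r₀).im = -Real.pi := by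
  -- multiplication by `I` carries the closed lower half plane without `0` to the slit plane
  have hs : ∀ r, Complex.I * Complex.exp (P r) ∈ Complex.slitPlane := fun r => by
    rw [Complex.mem_slitPlane_iff]
    rcases (him r).lt_or_eq with h | h
    · left; simpa using h
    · right
      intro h'
      have : (Complex.exp (P r)).re = 0 := by simpa using h'
      exact Complex.exp_ne_zero (P r) (Complex.ext this h)
  have hc : Continuous fun r => Complex.log (Complex.I * Complex.exp (P r)) :=
    Continuous.clog (by fun_prop) hs
  have hIpi : Complex.exp (Complex.I * (Real.pi / 2)) = Complex.I := by
    rw [mul_comm, Complex.exp_pi_div_two_mul_I]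
  have := log_sub_log_eq isPreconnected_univ (L := fun r => P r + Complex.I * (Real.pi / 2))
    (M := fun r => Complex.log (Complex.I * Complex.exp (P r)))
    (by fun_prop) hc.continuousOn (fun r _ => by
      rw [Complex.exp_log (Complex.slitPlane_ne_zero (hs r)), Complex.exp_add, hIpi, mul_comm])
    (Set.mem_univ r₀) (Set.mem_univ r₁)
  have e := congrArg Complex.im this
  have a0 : Complex.arg (Complex.I * Complex.exp (P r₀)) = Real.pi / 2 := by
    rw [h0, mul_one, Complex.arg_I]
  have a1 : Complex.arg (Complex.I * Complex.exp (P r₁)) = -(Real.pi / 2) := by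
    rw [Complex.arg_eq_neg_pi_div_two_iff, h1]
    simp [hq]
  simp only [Complex.sub_im, Complex.log_im, a0, a1] at e
  rw [Complex.sub_im]
  simp only [Complex.add_im] at e
  linarith

/-- A simple loop in `ℂ \ {0}` does not wind twice or more around the origin. A logarithm `L` of
it gives a curve in the plane that is disjoint from its translate by `2πi`. The difference of a
point of the translate and a point of the curve is a nonvanishing function of two real variables,
which has a logarithm of its own; comparing the values of the latter for the points of the loop
closest to and farthest from the origin gives a contradiction. -/
theorem HasWinding.lt_two {g : S1 → ℂ} {n : ℤ} (h : HasWinding g n)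
    (hinj : Function.Injective g) : n < 2 := by
  by_contra! hn2
  obtain ⟨L, hL, he, hn⟩ := h
  have hpi := Complex.two_pi_I_ne_zero
  have hcont : Continuous g := continuous_of_comp_coe (by
    simp only [← he]
    fun_prop)
  let G : ℝ × ℝ → ℂ := fun q => (L q.2 - L q.1) / (2 * Real.pi * Complex.I) + 1
  have hG0 : ∀ q, G q ≠ 0 := by
    rintro ⟨s, t⟩ h0
    have h1 : L s = L t + 2 * Real.pi * Complex.I := by
      simp only [G] at h0
      field_simp at h0
      linear_combination -h0
    have h2 : (s : S1) = t := by
      apply hinj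
      rw [← he, ← he, h1, Complex.exp_add, Complex.exp_two_pi_mul_I, mul_one]
    obtain ⟨k, hk⟩ := exists_int_of_coe_eq h2
    rw [hk, add_int_of_add_one hn] at h1
    have h3 : (2 * Real.pi * Complex.I : ℂ) * (n * k) = 2 * Real.pi * Complex.I * 1 := by
      linear_combination h1
    have h4 : n * k = 1 := by exact_mod_cast mul_left_cancel₀ hpi h3
    have := Int.eq_one_or_neg_one_of_mul_eq_one h4
    omega
  -- `G (s, t)` is `1` for `t = s` and `1 - n < 0` for `t = s - 1`, and it stays in a closed half
  -- plane for `t` in between if `g s` is closest to or farthest from the origin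
  obtain ⟨Θ, hΘ, hΘe⟩ := exists_continuous_log (g := G) (by fun_prop) hG0
  have him : ∀ s t, (G (s, t)).im = ((L s).re - (L t).re) / (2 * Real.pi) := fun s t => by
    have : (L t - L s) / (2 * Real.pi * Complex.I)
        = -((L t - L s) * Complex.I) / ((2 * Real.pi : ℝ) : ℂ) := by
      push_cast
      field_simp
      linear_combination (L t - L s) * Complex.I_sq
    simp only [G, this, Complex.add_im, Complex.one_im, Complex.div_ofReal_im]
    simp
  have hdiag : ∀ s, G (s, s) = 1 := fun s => by simp [G]
  have hend : ∀ s, G (s, s - 1) = ((1 - n : ℝ) : ℂ) := fun s => by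
    have := hn (s - 1)
    rw [sub_add_cancel] at this
    simp only [G, this]
    push_cast
    field_simp
    ring
  have hneg : (1 - n : ℝ) < 0 := by
    have : (2 : ℝ) ≤ n := by exact_mod_cast hn2
    linarith
  have hre : ∀ t : ℝ, Real.exp (L t).re = ‖g t‖ := fun t => by rw [← he, Complex.norm_exp]
  have hconst : ∀ s₀ s₁ : ℝ, Θ (s₀, s₀ - 1) - Θ (s₀, s₀) = Θ (s₁, s₁ - 1) - Θ (s₁, s₁) := by
    intro s₀ s₁
    have := log_sub_log_eq isPreconnected_univ (L := fun s : ℝ => Θ (s, s - 1) - Θ (s, s))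
      (M := fun _ => Complex.log ((1 - n : ℝ) : ℂ)) (by fun_prop) (by fun_prop) (fun s _ => by
        rw [Complex.exp_log (by exact_mod_cast hneg.ne), Complex.exp_sub, hΘe, hΘe, hdiag,
          hend, div_one]) (Set.mem_univ s₀) (Set.mem_univ s₁)
    exact sub_left_injective this
  -- by `hconst` the argument changes by the same amount for all `s`, whereas it changes by `-π` for
  -- the minimum `s₀` and by `π` for the maximum `s₁` of the distance to the origin
  obtain ⟨s₀, hs₀⟩ : ∃ s : ℝ, ∀ t : ℝ, (L s).re ≤ (L t).re := by
    obtain ⟨x, -, hx⟩ := isCompact_univ.exists_isMinOn Set.univ_nonempty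
      hcont.norm.continuousOn
    obtain ⟨s, rfl⟩ := QuotientAddGroup.mk_surjective x
    exact ⟨s, fun t => by rw [← Real.exp_le_exp, hre, hre]; exact hx (Set.mem_univ _)⟩
  obtain ⟨s₁, hs₁⟩ : ∃ s : ℝ, ∀ t : ℝ, (L t).re ≤ (L s).re := by
    obtain ⟨x, -, hx⟩ := isCompact_univ.exists_isMaxOn Set.univ_nonempty
      hcont.norm.continuousOn
    obtain ⟨s, rfl⟩ := QuotientAddGroup.mk_surjective x
    exact ⟨s, fun t => by rw [← Real.exp_le_exp, hre, hre]; exact hx (Set.mem_univ _)⟩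
  have e0 := im_log_sub_of_im_nonpos (P := fun r => Θ (s₀, r)) (by fun_prop)
    (fun r => by
      rw [hΘe, him]
      exact div_nonpos_of_nonpos_of_nonneg (sub_nonpos.2 (hs₀ r)) Real.two_pi_pos.le)
    (by rw [hΘe, hdiag]) hneg (by rw [hΘe, hend])
  have e1 := im_log_sub_of_im_nonpos (P := fun r => (starRingEnd ℂ) (Θ (s₁, r))) (by fun_prop)
    (fun r => by
      rw [Complex.exp_conj, hΘe, Complex.conj_im, him, Left.neg_nonpos_iff]
      exact div_nonneg (sub_nonneg.2 (hs₁ r)) Real.two_pi_pos.le)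
    (by rw [Complex.exp_conj, hΘe, hdiag, map_one]) hneg
    (by rw [Complex.exp_conj, hΘe, hend, Complex.conj_ofReal])
  rw [← map_sub, Complex.conj_im, ← hconst s₀ s₁, e0] at e1
  linarith [Real.pi_pos]

theorem HasWinding.natAbs_le_one {g : S1 → ℂ} {n : ℤ} (h : HasWinding g n)
    (hinj : Function.Injective g) : n.natAbs ≤ 1 := by
  have h1 := h.lt_two hinj
  have h2 := h.conj.lt_two ((starRingEnd ℂ).injective.comp hinj)
  omega

/-! ### Loops that cross the negative real axis -/

/-- The argument of a path grows by `2π` between two consecutive downward crossings of the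
negative real axis. -/
theorem log_eq_add_two_pi_I {L : ℝ → ℂ} (hL : Continuous L) {α β : ℝ} (hαβ : α < β)
    (hα : Complex.exp (L α) = -1) (hβ : Complex.exp (L β) = -1)
    (hs : ∀ t ∈ Set.Ioo α β, Complex.exp (L t) ∈ Complex.slitPlane)
    (hα' : ∀ᶠ t in nhdsWithin α (Set.Ioi α), (Complex.exp (L t)).im < 0)
    (hβ' : ∀ᶠ t in nhdsWithin β (Set.Iio β), 0 < (Complex.exp (L t)).im) :
    L β = L α + 2 * Real.pi * Complex.I := by
  have hc : ContinuousOn (fun t => Complex.log (Complex.exp (L t))) (Set.Ioo α β) :=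
    ContinuousOn.clog (by fun_prop) hs
  have hconst : ∀ x ∈ Set.Ioo α β, ∀ y ∈ Set.Ioo α β,
      L x - Complex.log (Complex.exp (L x)) = L y - Complex.log (Complex.exp (L y)) :=
    fun x hx y hy => log_sub_log_eq isPreconnected_Ioo hL.continuousOn hc
      (fun t _ => (Complex.exp_log (Complex.exp_ne_zero _)).symm) hx hy
  have ht1 : Filter.Tendsto (fun t => L t - Complex.log (Complex.exp (L t)))
      (nhdsWithin α (Set.Ioi α)) (nhds (L α + Real.pi * Complex.I)) := by
    have h1 := Complex.tendsto_log_nhdsWithin_im_neg_of_re_neg_of_im_zero (z := -1)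
      (by simp) (by simp)
    have h2 : Filter.Tendsto (fun t => Complex.exp (L t)) (nhdsWithin α (Set.Ioi α))
        (nhdsWithin (-1) {z : ℂ | z.im < 0}) :=
      tendsto_nhdsWithin_iff.2 ⟨hα ▸ ((Complex.continuous_exp.comp hL).tendsto α).mono_left
        nhdsWithin_le_nhds, hα'⟩
    have h3 := ((hL.tendsto α).mono_left nhdsWithin_le_nhds).sub (h1.comp h2)
    simpa using h3
  have ht2 : Filter.Tendsto (fun t => L t - Complex.log (Complex.exp (L t)))
      (nhdsWithin β (Set.Iio β)) (nhds (L β - Real.pi * Complex.I)) := by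
    have h1 := Complex.tendsto_log_nhdsWithin_im_nonneg_of_re_neg_of_im_zero (z := -1)
      (by simp) (by simp)
    have h2 : Filter.Tendsto (fun t => Complex.exp (L t)) (nhdsWithin β (Set.Iio β))
        (nhdsWithin (-1) {z : ℂ | 0 ≤ z.im}) :=
      tendsto_nhdsWithin_iff.2 ⟨hβ ▸ ((Complex.continuous_exp.comp hL).tendsto β).mono_left
        nhdsWithin_le_nhds, hβ'.mono fun _ h => h.le⟩
    have h3 := ((hL.tendsto β).mono_left nhdsWithin_le_nhds).sub (h1.comp h2)
    simpa using h3
  obtain ⟨m, hm⟩ : (Set.Ioo α β).Nonempty := Set.nonempty_Ioo.2 hαβ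
  have e1 : L α + Real.pi * Complex.I = L m - Complex.log (Complex.exp (L m)) :=
    tendsto_nhds_unique ht1 (tendsto_const_nhds.congr' (by
      filter_upwards [Ioo_mem_nhdsGT hαβ] with t ht using hconst m hm t ht))
  have e2 : L β - Real.pi * Complex.I = L m - Complex.log (Complex.exp (L m)) :=
    tendsto_nhds_unique ht2 (tendsto_const_nhds.congr' (by
      filter_upwards [Ioo_mem_nhdsLT hαβ] with t ht using hconst m hm t ht))
  linear_combination e2 - e1

/-- The loop `g` passes from the upper to the lower half plane at the time `s`. -/
def CrossesDown (g : S1 → ℂ) (s : ℝ) : Prop :=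
  ∀ᶠ x : ℝ in nhds s, (x < s → 0 < (g x).im) ∧ (s < x → (g x).im < 0)

theorem CrossesDown.add_one {g : S1 → ℂ} {s : ℝ} (h : CrossesDown g s) :
    CrossesDown g (s + 1) := by
  have : Filter.Tendsto (fun x : ℝ => x - 1) (nhds (s + 1)) (nhds s) := by
    have := (continuous_sub_right (1 : ℝ)).tendsto (s + 1)
    rwa [add_sub_cancel_right] at this
  refine (this.eventually h).mono fun x hx => ?_
  have e : ((x - 1 : ℝ) : S1) = x := by rw [← coe_add_one, sub_add_cancel]
  rw [e] at hx
  exact ⟨fun h => hx.1 (by linarith), fun h => hx.2 (by linarith)⟩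

theorem CrossesDown.eventually_right {g : S1 → ℂ} {s : ℝ} (h : CrossesDown g s) :
    ∀ᶠ x : ℝ in nhdsWithin s (Set.Ioi s), (g x).im < 0 := by
  filter_upwards [nhdsWithin_le_nhds h, self_mem_nhdsWithin] with x hx hs using hx.2 hs

theorem CrossesDown.eventually_left {g : S1 → ℂ} {s : ℝ} (h : CrossesDown g s) :
    ∀ᶠ x : ℝ in nhdsWithin s (Set.Iio s), 0 < (g x).im := by
  filter_upwards [nhdsWithin_le_nhds h, self_mem_nhdsWithin] with x hx hs using hx.1 hs

/-- A loop that meets the closed negative real axis exactly twice, crossing it downwards both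
times, winds twice around the origin. -/
theorem HasWinding.eq_two {g : S1 → ℂ} {n : ℤ} (h : HasWinding g n) {s t : ℝ}
    (hst : s < t) (hts : t < s + 1) (hs : g s = -1) (ht : g t = -1)
    (hslit : ∀ x : S1, x ≠ s → x ≠ t → g x ∈ Complex.slitPlane)
    (hs' : CrossesDown g s) (ht' : CrossesDown g t) : n = 2 := by
  obtain ⟨L, hL, he, hn⟩ := h
  have hne : ∀ x y : ℝ, x < y → y < x + 1 → (y : S1) ≠ x := fun x y h1 h2 hxy => by
    obtain ⟨k, rfl⟩ := exists_int_of_coe_eq hxy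
    have h3 : 0 < k := by exact_mod_cast (lt_add_iff_pos_right x).1 h1
    have h4 : k < 1 := by exact_mod_cast (add_lt_add_iff_left x).1 h2
    omega
  have e1 := log_eq_add_two_pi_I hL hst (by rw [he, hs]) (by rw [he, ht])
    (fun x hx => by
      rw [he]
      exact hslit x (hne s x hx.1 (by linarith [hx.2])) (hne x t hx.2 (by linarith [hx.1])).symm)
    (by simpa only [he] using hs'.eventually_right)
    (by simpa only [he] using ht'.eventually_left)
  have e2 := log_eq_add_two_pi_I hL hts (by rw [he, ht]) (by rw [he, coe_add_one, hs])
    (fun x hx => by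
      rw [he]
      exact hslit x (hne s x (hst.trans hx.1) hx.2) (hne t x hx.1 (by linarith [hx.2])))
    (by simpa only [he] using ht'.eventually_right)
    (by simpa only [he] using hs'.add_one.eventually_left)
  rw [hn, e1] at e2
  have e3 : (2 * Real.pi * Complex.I : ℂ) * n = 2 * Real.pi * Complex.I * 2 := by
    linear_combination e2
  exact_mod_cast mul_left_cancel₀ Complex.two_pi_I_ne_zero e3

/-! ### Stereographic coordinates -/

/-- The ambient space of the 2-sphere. -/
abbrev E3 : Type := EuclideanSpace ℝ (Fin 3)

section frame

variable (b : OrthonormalBasis (Fin 3) ℝ E3)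

/-- The first two coordinates in the frame `b`, as a complex number. -/
noncomputable def horizontal : E3 →L[ℝ] ℂ :=
  (innerSL ℝ (b 0)).smulRight (1 : ℂ) + (innerSL ℝ (b 1)).smulRight Complex.I

/-- The third coordinate in the frame `b`. -/
noncomputable def height : E3 →L[ℝ] ℝ := innerSL ℝ (b 2)

/-- Stereographic projection from the pole `b 2`, where it has the junk value `0`. -/
noncomputable def stereo (x : E3) : ℂ := horizontal b x / (1 - height b x : ℝ)

theorem horizontal_re (x : E3) : (horizontal b x).re = inner ℝ (b 0) x := by
  simp [horizontal]

theorem horizontal_im (x : E3) : (horizontal b x).im = inner ℝ (b 1) x := by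
  simp [horizontal]

theorem inner_eq (x y : E3) : inner ℝ x y = (horizontal b x).re * (horizontal b y).re +
    (horizontal b x).im * (horizontal b y).im + height b x * height b y := by
  rw [← b.sum_inner_mul_inner x y, Fin.sum_univ_three]
  simp only [horizontal_re, horizontal_im, height, innerSL_apply_apply, real_inner_comm]

theorem eq_of_coordinates {x y : E3} (h1 : horizontal b x = horizontal b y)
    (h2 : height b x = height b y) : x = y := by
  rw [← sub_eq_zero, ← inner_self_eq_zero (𝕜 := ℝ), inner_eq b]
  simp [h1, h2]

theorem sq_coordinates (x : S2) : (horizontal b x).re ^ 2 + (horizontal b x).im ^ 2 +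
    height b x ^ 2 = 1 := by
  have h := inner_eq b x x
  rw [real_inner_self_eq_norm_sq, norm_eq_of_mem_sphere] at h
  linarith

theorem height_le_one (x : S2) : height b x ≤ 1 := by
  nlinarith [sq_coordinates b x, sq_nonneg (horizontal b x).re, sq_nonneg (horizontal b x).im,
    sq_nonneg (height b x - 1)]

theorem neg_one_le_height (x : S2) : -1 ≤ height b x := by
  nlinarith [sq_coordinates b x, sq_nonneg (horizontal b x).re, sq_nonneg (horizontal b x).im,
    sq_nonneg (height b x + 1)]

theorem horizontal_of_height_eq_one {x : S2} (h : height b x = 1) : horizontal b x = 0 := by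
  have := sq_coordinates b x
  rw [h] at this
  apply Complex.ext <;> simp <;> nlinarith [sq_nonneg (horizontal b x).re,
    sq_nonneg (horizontal b x).im]

theorem height_eq_one_iff {x : S2} : height b x = 1 ↔ (x : E3) = b 2 := by
  have hb : height b (b 2) = 1 := by simp [height]
  refine ⟨fun h => eq_of_coordinates b ?_ (h.trans hb.symm), fun h => h ▸ hb⟩
  rw [horizontal_of_height_eq_one b h]
  apply Complex.ext
  · rw [horizontal_re, b.inner_eq_zero (by decide)]; rfl
  · rw [horizontal_im, b.inner_eq_zero (by decide)]; rfl

theorem normSq_stereo {x : S2} (hx : height b x ≠ 1) :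
    Complex.normSq (stereo b x) = (1 + height b x) / (1 - height b x) := by
  have h1 : (1 - height b x) ≠ 0 := sub_ne_zero.2 hx.symm
  rw [stereo, map_div₀, Complex.normSq_ofReal, Complex.normSq_apply]
  field_simp
  linear_combination sq_coordinates b x

theorem stereo_injective {x y : S2} (hx : height b x ≠ 1) (hy : height b y ≠ 1)
    (h : stereo b x = stereo b y) : x = y := by
  have h1 : (1 - height b x) ≠ 0 := sub_ne_zero.2 hx.symm
  have h2 : (1 - height b y) ≠ 0 := sub_ne_zero.2 hy.symm
  have h3 := normSq_stereo b hx
  rw [h, normSq_stereo b hy] at h3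
  have h4 : height b x = height b y := by
    field_simp at h3
    linarith
  refine Subtype.ext (eq_of_coordinates b ?_ h4)
  rw [stereo, stereo, h4] at h
  exact (div_left_inj' (by exact_mod_cast h2)).1 h

theorem exists_stereo_eq (c : ℂ) : ∃ x : S2, height b x ≠ 1 ∧ stereo b x = c := by
  have hc : 0 < Complex.normSq c + 1 := by linarith [Complex.normSq_nonneg c]
  let y : E3 := (2 * c.re / (Complex.normSq c + 1)) • b 0 +
    (2 * c.im / (Complex.normSq c + 1)) • b 1 +
    ((Complex.normSq c - 1) / (Complex.normSq c + 1)) • b 2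
  have h0 : (horizontal b y).re = 2 * c.re / (Complex.normSq c + 1) := by
    rw [horizontal_re]
    simp [y, inner_add_right, inner_smul_right, b.inner_eq_ite]
  have h1 : (horizontal b y).im = 2 * c.im / (Complex.normSq c + 1) := by
    rw [horizontal_im]
    simp [y, inner_add_right, inner_smul_right, b.inner_eq_ite]
  have h2 : height b y = (Complex.normSq c - 1) / (Complex.normSq c + 1) := by
    simp [height, y, inner_add_right, inner_smul_right, b.inner_eq_ite]
  have hy : y ∈ Metric.sphere (0 : E3) 1 := by
    have : inner ℝ y y = 1 := by
      rw [inner_eq b, h0, h1, h2]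
      field_simp
      rw [Complex.normSq_apply]
      ring
    rw [mem_sphere_zero_iff_norm]
    rw [real_inner_self_eq_norm_sq] at this
    exact (pow_eq_one_iff_of_nonneg (norm_nonneg y) two_ne_zero).1 this
  have h3 : 1 - height b y = 2 / (Complex.normSq c + 1) := by
    rw [h2]; field_simp; ring
  refine ⟨⟨y, hy⟩, fun h => ?_, ?_⟩
  · rw [h, sub_self] at h3
    have : 0 < 2 / (Complex.normSq c + 1) := by positivity
    linarith
  · rw [stereo, h3]
    apply Complex.ext
    · rw [Complex.div_ofReal_re, h0]; field_simp
    · rw [Complex.div_ofReal_im, h1]; field_simp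

theorem continuousAt_stereo {x : E3} (hx : height b x ≠ 1) : ContinuousAt (stereo b) x := by
  refine ContinuousAt.div (by fun_prop) (by fun_prop) ?_
  exact_mod_cast sub_ne_zero.2 hx.symm

/-- The stereographic projection is an immersion: it carries transverse curves on the sphere to
transverse curves in the plane. -/
theorem exists_hasDerivAt_stereo {γ : ℝ → S2} (hγ : Differentiable ℝ fun t => (γ t : E3))
    {s t : ℝ} (hst : γ s = γ t) (hs : height b (γ s) ≠ 1)
    (hli : LinearIndependent ℝ ![deriv (fun t => (γ t : E3)) s, deriv (fun t => (γ t : E3)) t]) :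
    ∃ v w : ℂ, HasDerivAt (fun x => stereo b (γ x)) v s ∧
      HasDerivAt (fun x => stereo b (γ x)) w t ∧
      ∀ c d : ℝ, c * v + d * w = 0 → c = 0 ∧ d = 0 := by
  have hd : ∀ r, height b (γ r) ≠ 1 → HasDerivAt (fun x => stereo b (γ x))
      ((horizontal b (deriv (fun t => (γ t : E3)) r) * ((1 - height b (γ r) : ℝ) : ℂ) -
        horizontal b (γ r) * ((-height b (deriv (fun t => (γ t : E3)) r) : ℝ) : ℂ)) /
        ((1 - height b (γ r) : ℝ) : ℂ) ^ 2) r := fun r hr => by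
    have h1 := (hγ r).hasDerivAt
    have h2 := (horizontal b).hasFDerivAt.comp_hasDerivAt r h1
    have h3 := (((height b).hasFDerivAt.comp_hasDerivAt r h1).const_sub 1).ofReal_comp
    exact h2.div h3 (by exact_mod_cast sub_ne_zero.2 hr.symm)
  have htan : ∀ r, inner ℝ (γ r : E3) (deriv (fun t => (γ t : E3)) r) = 0 := fun r => by
    have h1 := (hγ r).hasDerivAt
    have h2 := h1.inner ℝ h1
    have h3 : (fun t => inner ℝ (γ t : E3) (γ t : E3)) = fun _ => (1 : ℝ) := by
      funext t
      rw [real_inner_self_eq_norm_sq, norm_eq_of_mem_sphere, one_pow]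
    rw [h3] at h2
    have h4 := h2.unique (hasDerivAt_const r 1)
    rw [real_inner_comm (γ r : E3) (deriv (fun t => (γ t : E3)) r)] at h4
    linarith
  refine ⟨_, _, hd s hs, hd t (hst ▸ hs), fun c d hcd => ?_⟩
  rw [← hst] at hcd
  have ht := htan t
  rw [← hst] at ht
  have hp := sq_coordinates b (γ s)
  set p : E3 := (γ s : E3)
  set v := deriv (fun t => (γ t : E3)) s
  set w := deriv (fun t => (γ t : E3)) t
  have h1 : (1 - height b p) ≠ 0 := sub_ne_zero.2 hs.symm
  have h1' : ((1 - height b p : ℝ) : ℂ) ≠ 0 := by exact_mod_cast h1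
  have hz : horizontal b (c • v + d • w) * ((1 - height b p : ℝ) : ℂ) +
      horizontal b p * ((height b (c • v + d • w) : ℝ) : ℂ) = 0 := by
    have h2 : ((c * horizontal b v + d * horizontal b w) * ((1 - height b p : ℝ) : ℂ) +
      horizontal b p * (c * height b v + d * height b w)) / ((1 - height b p : ℝ) : ℂ) ^ 2 = 0 := by
      rw [← hcd]; push_cast; ring
    have h3 := (div_eq_zero_iff.1 h2).resolve_right (pow_ne_zero 2 h1')
    rw [← h3]
    simp
  have hinner : inner ℝ p (c • v + d • w) = 0 := by
    rw [inner_add_right, inner_smul_right, inner_smul_right, htan s, ht]; simp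
  have hzero : c • v + d • w = 0 := by
    rw [inner_eq b] at hinner
    have hre := congrArg Complex.re hz
    have him := congrArg Complex.im hz
    rw [Complex.add_re, Complex.re_mul_ofReal, Complex.re_mul_ofReal, Complex.zero_re] at hre
    rw [Complex.add_im, Complex.im_mul_ofReal, Complex.im_mul_ofReal, Complex.zero_im] at him
    have h2 : (1 - height b p) * height b (c • v + d • w) = 0 := by
      linear_combination (horizontal b p).re * hre + (horizontal b p).im * him -
        (1 - height b p) * hinner - height b (c • v + d • w) * hp
    have h3 := (mul_eq_zero.1 h2).resolve_left h1
    rw [h3] at hre him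
    refine eq_of_coordinates b ?_ (by rw [h3, map_zero])
    rw [map_zero]
    apply Complex.ext
    · simpa [h1] using hre
    · simpa [h1] using him
  exact LinearIndependent.pair_iff.1 hli c d hzero

/-! ### The annulus between two points -/

/-- In the stereographic coordinate `z`, this is `(z - a) * conj (z - c)` times the factor
`1 - height`, which makes it continuous at the pole. -/
noncomputable def annulusNum (a c : ℂ) (x : E3) : ℂ :=
  ((1 + height b x : ℝ) : ℂ) - (starRingEnd ℂ) c * horizontal b x -
    a * (starRingEnd ℂ) (horizontal b x) + a * (starRingEnd ℂ) c * ((1 - height b x : ℝ) : ℂ)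

/-- The Möbius map `z ↦ (z - a) / (z - c)` on the sphere, in the stereographic coordinate `z`. It
carries the complement of the points with coordinates `a` and `c` into `ℂ \ {0}` and has the value
`1` at the pole. At the point with coordinate `c` it has the junk value `0`. -/
noncomputable def annulusMap (a c : ℂ) (x : E3) : ℂ := annulusNum b a c x / annulusNum b c c x

theorem annulusNum_eq (a c : ℂ) {x : S2} (hx : height b x ≠ 1) : annulusNum b a c x =
    ((1 - height b x : ℝ) : ℂ) * ((stereo b x - a) * (starRingEnd ℂ) (stereo b x - c)) := by
  have h1 : (1 - height b x) ≠ 0 := sub_ne_zero.2 hx.symm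
  have h1' : ((1 - height b x : ℝ) : ℂ) ≠ 0 := by exact_mod_cast h1
  have h2 : stereo b x * (starRingEnd ℂ) (stereo b x) * ((1 - height b x : ℝ) : ℂ)
      = ((1 + height b x : ℝ) : ℂ) := by
    rw [Complex.mul_conj, normSq_stereo b hx, ← Complex.ofReal_mul, div_mul_cancel₀ _ h1]
  have h3 : horizontal b x = stereo b x * ((1 - height b x : ℝ) : ℂ) := by
    rw [stereo, div_mul_cancel₀ _ h1']
  rw [annulusNum, h3, ← h2, map_mul, Complex.conj_ofReal, map_sub]
  ring

theorem annulusNum_pole (a c : ℂ) {x : S2} (hx : height b x = 1) : annulusNum b a c x = 2 := by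
  rw [annulusNum, horizontal_of_height_eq_one b hx, hx]
  norm_num

theorem annulusNum_ne_zero {a c : ℂ} {x : S2} (ha : height b x ≠ 1 → stereo b x ≠ a)
    (hc : height b x ≠ 1 → stereo b x ≠ c) : annulusNum b a c x ≠ 0 := by
  by_cases hx : height b x = 1
  · rw [annulusNum_pole b a c hx]; norm_num
  · rw [annulusNum_eq b a c hx]
    refine mul_ne_zero (by exact_mod_cast sub_ne_zero.2 (Ne.symm hx)) (mul_ne_zero
      (sub_ne_zero.2 (ha hx)) ?_)
    exact (map_ne_zero _).2 (sub_ne_zero.2 (hc hx))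

theorem annulusMap_eq (a c : ℂ) {x : S2} (hx : height b x ≠ 1) :
    annulusMap b a c x = (stereo b x - a) / (stereo b x - c) := by
  have h1' : ((1 - height b x : ℝ) : ℂ) ≠ 0 := by exact_mod_cast sub_ne_zero.2 hx.symm
  rw [annulusMap, annulusNum_eq b a c hx, annulusNum_eq b c c hx, mul_div_mul_left _ _ h1']
  by_cases hc : stereo b x - c = 0
  · simp [hc]
  · rw [mul_div_mul_right _ _ ((map_ne_zero _).2 hc)]

theorem annulusMap_pole (a c : ℂ) {x : S2} (hx : height b x = 1) : annulusMap b a c x = 1 := by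
  rw [annulusMap, annulusNum_pole b a c hx, annulusNum_pole b c c hx, div_self two_ne_zero]

theorem annulusMap_injective {a c : ℂ} (hac : a ≠ c) {x y : S2}
    (hx : height b x ≠ 1 → stereo b x ≠ c) (hy : height b y ≠ 1 → stereo b y ≠ c)
    (h : annulusMap b a c x = annulusMap b a c y) : x = y := by
  have key : ∀ {x : S2}, height b x ≠ 1 → stereo b x ≠ c → annulusMap b a c x ≠ 1 := by
    intro x h1 h2 h3
    rw [annulusMap_eq b a c h1, div_eq_one_iff_eq (sub_ne_zero.2 h2)] at h3
    exact hac (sub_right_injective h3)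
  by_cases h1 : height b x = 1 <;> by_cases h2 : height b y = 1
  · exact Subtype.ext (((height_eq_one_iff b).1 h1).trans ((height_eq_one_iff b).1 h2).symm)
  · exact absurd (h.symm.trans (annulusMap_pole b a c h1)) (key h2 (hy h2))
  · exact absurd (h.trans (annulusMap_pole b a c h2)) (key h1 (hx h1))
  · refine stereo_injective b h1 h2 ?_
    rw [annulusMap_eq b a c h1, annulusMap_eq b a c h2,
      div_eq_div_iff (sub_ne_zero.2 (hx h1)) (sub_ne_zero.2 (hy h2))] at h
    have h3 : (a - c) * (stereo b x - stereo b y) = 0 := by linear_combination h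
    exact sub_eq_zero.1 ((mul_eq_zero.1 h3).resolve_left (sub_ne_zero.2 hac))

theorem continuous_annulusNum : Continuous fun q : (ℂ × ℂ) × E3 =>
    annulusNum b q.1.1 q.1.2 q.2 := by
  unfold annulusNum
  fun_prop

theorem annulusNum_self_ne_zero {v x : S2} (hv : height b v ≠ 1) (hx : x ≠ v) :
    annulusNum b (stereo b v) (stereo b v) x ≠ 0 :=
  annulusNum_ne_zero b (fun h e => hx (stereo_injective b h hv e))
    fun h e => hx (stereo_injective b h hv e)

theorem annulusMap_ne_zero {u v x : S2} (hu : height b u ≠ 1) (hv : height b v ≠ 1)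
    (hxu : x ≠ u) (hxv : x ≠ v) : annulusMap b (stereo b u) (stereo b v) x ≠ 0 :=
  div_ne_zero (annulusNum_ne_zero b (fun h e => hxu (stereo_injective b h hu e))
    fun h e => hxv (stereo_injective b h hv e)) (annulusNum_self_ne_zero b hv hxv)

theorem continuousOn_annulusMap : ContinuousOn
    (fun q : (S2 × S2) × S2 => annulusMap b (stereo b q.1.1) (stereo b q.1.2) q.2)
    {q | height b q.1.1 ≠ 1 ∧ height b q.1.2 ≠ 1 ∧ q.2 ≠ q.1.2} := by
  rintro ⟨⟨u, v⟩, x⟩ ⟨hu, hv, hx⟩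
  refine ContinuousAt.continuousWithinAt ?_
  have h1 : ContinuousAt (fun q : (S2 × S2) × S2 => stereo b q.1.1) ((u, v), x) :=
    ContinuousAt.comp (g := stereo b) (f := fun q : (S2 × S2) × S2 => (q.1.1 : E3))
      (continuousAt_stereo b hu) (by fun_prop)
  have h2 : ContinuousAt (fun q : (S2 × S2) × S2 => stereo b q.1.2) ((u, v), x) :=
    ContinuousAt.comp (g := stereo b) (f := fun q : (S2 × S2) × S2 => (q.1.2 : E3))
      (continuousAt_stereo b hv) (by fun_prop)
  have h3 : ContinuousAt (fun q : (S2 × S2) × S2 => (q.2 : E3)) ((u, v), x) := by fun_prop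
  have h4 : ContinuousAt (fun q : (S2 × S2) × S2 =>
      annulusNum b (stereo b q.1.1) (stereo b q.1.2) q.2) ((u, v), x) :=
    ContinuousAt.comp (g := fun q : (ℂ × ℂ) × E3 => annulusNum b q.1.1 q.1.2 q.2)
      (f := fun q : (S2 × S2) × S2 => ((stereo b q.1.1, stereo b q.1.2), (q.2 : E3)))
      (continuous_annulusNum b).continuousAt ((h1.prodMk h2).prodMk h3)
  have h5 : ContinuousAt (fun q : (S2 × S2) × S2 =>
      annulusNum b (stereo b q.1.2) (stereo b q.1.2) q.2) ((u, v), x) :=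
    ContinuousAt.comp (g := fun q : (ℂ × ℂ) × E3 => annulusNum b q.1.1 q.1.2 q.2)
      (f := fun q : (S2 × S2) × S2 => ((stereo b q.1.2, stereo b q.1.2), (q.2 : E3)))
      (continuous_annulusNum b).continuousAt ((h2.prodMk h2).prodMk h3)
  exact h4.div h5 (annulusNum_self_ne_zero b hv hx)

theorem continuousOn_annulusMap_right {u v : S2} (hu : height b u ≠ 1) (hv : height b v ≠ 1) :
    ContinuousOn (fun x : S2 => annulusMap b (stereo b u) (stereo b v) x) {v}ᶜ :=
  (continuousOn_annulusMap b).comp (f := fun x : S2 => ((u, v), x)) (by fun_prop)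
    fun _ hx => ⟨hu, hv, hx⟩

/-! ### The winding number between opposite corners of a crossing -/

theorem Diagram.continuous_curve (D : Diagram) : Continuous D.curve :=
  continuous_of_comp_coe (continuous_induced_rng.2 D.smooth.continuous)

theorem im_sign_of_hasDerivAt {f : ℝ → ℂ} {c : ℂ} {s : ℝ} (h : HasDerivAt f c s)
    (hc : 0 < c.im) (h0 : f s = 0) :
    ∀ᶠ x in nhds s, (x < s → (f x).im < 0) ∧ (s < x → 0 < (f x).im) := by
  have h1 : HasDerivAt (fun x => (f x).im) c.im s :=
    Complex.imCLM.hasFDerivAt.comp_hasDerivAt s h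
  have h2 := (hasDerivAt_iff_tendsto_slope.1 h1).eventually (lt_mem_nhds hc)
  rw [eventually_nhdsWithin_iff] at h2
  filter_upwards [h2] with x hx
  constructor
  · intro hlt
    have h3 := hx hlt.ne
    rw [slope_def_field, h0, Complex.zero_im, sub_zero] at h3
    rcases div_pos_iff.1 h3 with h4 | h4 <;> linarith
  · intro hlt
    have h3 := hx hlt.ne'
    rw [slope_def_field, h0, Complex.zero_im, sub_zero] at h3
    rcases div_pos_iff.1 h3 with h4 | h4 <;> linarith

theorem im_add_div_sub (ζ : ℂ) (ε : ℝ) :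
    ((ζ + ε) / (ζ - ε)).im = -(2 * ε * ζ.im) / Complex.normSq (ζ - ε) := by
  rw [Complex.div_im]
  simp
  ring

theorem re_add_div_sub (ζ : ℂ) (ε : ℝ) :
    ((ζ + ε) / (ζ - ε)).re = (Complex.normSq ζ - ε ^ 2) / Complex.normSq (ζ - ε) := by
  rw [Complex.div_re, Complex.normSq_apply ζ]
  simp
  ring

/-- The map `ζ ↦ (ζ + ε) / (ζ - ε)` takes values in the closed negative real axis only on the
segment between `-ε` and `ε`. -/
theorem add_div_sub_mem_slitPlane {ζ : ℂ} {ε : ℝ} (hε : 0 < ε) (h : ζ.im = 0 → ε < ‖ζ‖) :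
    (ζ + ε) / (ζ - ε) ∈ Complex.slitPlane := by
  have hne : ζ - ε ≠ 0 := fun h0 => by
    have h1 : ζ = ε := sub_eq_zero.1 h0
    have h2 := h (by simp [h1])
    rw [h1, Complex.norm_real, Real.norm_of_nonneg hε.le] at h2
    exact lt_irrefl _ h2
  have hpos : 0 < Complex.normSq (ζ - ε) := Complex.normSq_pos.2 hne
  rw [Complex.mem_slitPlane_iff, im_add_div_sub, re_add_div_sub]
  by_cases him : ζ.im = 0
  · left
    refine div_pos (sub_pos.2 ?_) hpos
    rw [Complex.normSq_eq_norm_sq]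
    exact pow_lt_pow_left₀ (h him) hε.le two_ne_zero
  · right
    exact div_ne_zero (neg_ne_zero.2 (mul_ne_zero (by positivity) him)) hpos.ne'

theorem crossesDown_of_im_sign {g ζ : S1 → ℂ} {ε : ℝ} (hε : 0 < ε) {s : ℝ}
    (hg : ∀ᶠ x : ℝ in nhds s, g x = (ζ x + ε) / (ζ x - ε))
    (h : ∀ᶠ x : ℝ in nhds s, (x < s → (ζ x).im < 0) ∧ (s < x → 0 < (ζ x).im)) :
    CrossesDown g s := by
  have hpos : ∀ z : ℂ, z.im ≠ 0 → 0 < Complex.normSq (z - ε) := fun z hz => by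
    refine Complex.normSq_pos.2 fun h0 => hz ?_
    rw [sub_eq_zero.1 h0, Complex.ofReal_im]
  filter_upwards [hg, h] with x hgx hx
  rw [hgx, im_add_div_sub]
  refine ⟨fun hxs => div_pos ?_ (hpos _ (hx.1 hxs).ne),
    fun hxs => div_neg_of_neg_of_pos ?_ (hpos _ (hx.2 hxs).ne')⟩
  · nlinarith [hx.1 hxs]
  · nlinarith [hx.2 hxs]

/-- There are two points of the sphere such that the diagram winds twice around the annulus
between them: they are taken in opposite corners of the crossing, close to it. -/
theorem Diagram.exists_hasWinding_two (D : Diagram) {s t : ℝ} (hst : (s : S1) ≠ t)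
    (hcross : D.curve s = D.curve t) (hpole : height b (D.curve s) ≠ 1) :
    ∃ u v : S2, height b u ≠ 1 ∧ height b v ≠ 1 ∧ u ∉ D.image ∧ v ∉ D.image ∧
      HasWinding (fun x => annulusMap b (stereo b u) (stereo b v) (D.curve x)) 2 := by
  -- shift `t` by an integer
  wlog hlt : s < t ∧ t < s + 1 generalizing t
  · obtain ⟨t', ht', e⟩ : (t : S1) ∈ (fun x : ℝ => (x : S1)) '' Set.Ico s (s + 1) := by
      have := AddCircle.coe_image_Ico_eq (1 : ℝ) s
      rw [this]; trivial
    simp only at e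
    refine this (t := t') (e ▸ hst) (e ▸ hcross) ⟨lt_of_le_of_ne ht'.1 ?_, ht'.2⟩
    rintro rfl
    exact hst e
  obtain ⟨hst1, hst2⟩ := hlt
  obtain ⟨α, β, hα, hβ, hαβ⟩ := exists_hasDerivAt_stereo b (γ := fun x : ℝ => D.curve x)
    (D.smooth.differentiable (by simp)) hcross hpole (D.transverse s t hst hcross)
  have hne : α - β ≠ 0 := fun h => by
    have := (hαβ 1 (-1) (by push_cast; linear_combination h)).1
    norm_num at this
  -- both strands point to the same side of the line through the crossing with direction `α - β`
  let κ : ℝ := (α / (α - β)).im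
  have hκ : κ ≠ 0 := fun h => by
    have h1 : α / (α - β) = ((α / (α - β)).re : ℂ) := Complex.ext rfl (by simpa using h)
    rw [div_eq_iff hne] at h1
    have h2 := hαβ (1 - (α / (α - β)).re) (α / (α - β)).re (by
      push_cast; linear_combination h1)
    linarith [h2.1, h2.2]
  let w : ℂ := κ * (α - β)
  have hκ' : (κ : ℂ) ≠ 0 := by exact_mod_cast hκ
  have hw : w ≠ 0 := mul_ne_zero hκ' hne
  have hwα : (α / w).im = 1 := by
    have : α / w = α / (α - β) / (κ : ℝ) := by simp only [w]; field_simp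
    rw [this, Complex.div_ofReal_im]
    exact div_self hκ
  have hwβ : (β / w).im = 1 := by
    have : β / w = α / w - ((1 / κ : ℝ) : ℂ) := by simp only [w]; push_cast; field_simp; ring
    rw [this, Complex.sub_im, Complex.ofReal_im, hwα, sub_zero]
  let q : ℂ := stereo b (D.curve s)
  let ζ : S1 → ℂ := fun x => (stereo b (D.curve x) - q) / w
  have hζs : ζ s = 0 := by simp [ζ, q]
  have hζt : ζ t = 0 := by simp [ζ, q, hcross]
  have hsign_s := im_sign_of_hasDerivAt (f := fun x : ℝ => ζ x) ((hα.sub_const q).div_const w)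
    (by rw [hwα]; exact one_pos) hζs
  have hsign_t := im_sign_of_hasDerivAt (f := fun x : ℝ => ζ x) ((hβ.sub_const q).div_const w)
    (by rw [hwβ]; exact one_pos) hζt
  -- near the crossing, the curve meets that line only in the crossing
  let A : Set S1 := {y | (ζ y).im = 0 → y = s ∨ y = t}
  have hopen : IsOpenMap ((↑) : ℝ → S1) := QuotientAddGroup.isOpenMap_coe
  have hAs : A ∈ nhds (s : S1) := by
    refine Filter.mem_of_superset (hopen.image_mem_nhds hsign_s) ?_
    rintro _ ⟨x, hx, rfl⟩ h0
    rcases lt_trichotomy x s with h | h | h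
    · exact absurd h0 (hx.1 h).ne
    · exact Or.inl (by rw [h])
    · exact absurd h0 (hx.2 h).ne'
  have hAt : A ∈ nhds (t : S1) := by
    refine Filter.mem_of_superset (hopen.image_mem_nhds hsign_t) ?_
    rintro _ ⟨x, hx, rfl⟩ h0
    rcases lt_trichotomy x t with h | h | h
    · exact absurd h0 (hx.1 h).ne
    · exact Or.inr (by rw [h])
    · exact absurd h0 (hx.2 h).ne'
  -- away from the crossing, the curve keeps a positive distance from it
  obtain ⟨m, hm, hmK⟩ : ∃ m : ℝ, 0 < m ∧ ∀ y ∈ (interior A)ᶜ,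
      m ≤ ‖annulusNum b q q (D.curve y)‖ := by
    refine (isOpen_interior.isClosed_compl.isCompact).exists_forall_le' ?_ fun y hy => ?_
    · refine ((continuous_annulusNum b).comp (f := fun y : S1 => ((q, q), (D.curve y : E3)))
        ?_).norm.continuousOn
      have := D.continuous_curve
      fun_prop
    · refine norm_pos_iff.2 (annulusNum_self_ne_zero b hpole fun h => ?_)
      have hys : (s : S1) ≠ y := by
        rintro rfl
        exact hy (mem_interior_iff_mem_nhds.2 hAs)
      have hyt : (t : S1) ≠ y := by
        rintro rfl
        exact hy (mem_interior_iff_mem_nhds.2 hAt)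
      exact D.no_triple s t y hst hyt hys hcross (hcross.symm.trans h.symm)
  obtain ⟨ε, hε, hεm⟩ : ∃ ε : ℝ, 0 < ε ∧ 2 * (ε * ‖w‖) ^ 2 < m := by
    have hw' : 0 < ‖w‖ := norm_pos_iff.2 hw
    refine ⟨√m / (2 * ‖w‖), by positivity, ?_⟩
    have : √m / (2 * ‖w‖) * ‖w‖ = √m / 2 := by field_simp
    rw [this, div_pow, Real.sq_sqrt hm.le]
    linarith
  have hstar : ∀ y : S1, height b (D.curve y) ≠ 1 → (ζ y).im = 0 → ‖ζ y‖ ≤ ε →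
      y = s ∨ y = t := by
    intro y hy him hle
    by_contra hcon
    have hyA : y ∈ (interior A)ᶜ := fun h => hcon (interior_subset h him)
    have h1 := hmK y hyA
    have h2 : stereo b (D.curve y) - q = ζ y * w := by simp only [ζ]; field_simp
    rw [annulusNum_eq b q q hy, h2, norm_mul, norm_mul, RCLike.norm_conj, norm_mul,
      Complex.norm_real, Real.norm_of_nonneg (sub_nonneg.2 (height_le_one b _))] at h1
    have h3 := neg_one_le_height b (D.curve y)
    have h4 : ‖ζ y‖ * ‖w‖ ≤ ε * ‖w‖ := by gcongr
    have h5 : (‖ζ y‖ * ‖w‖) * (‖ζ y‖ * ‖w‖) ≤ (ε * ‖w‖) ^ 2 := by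
      rw [← sq]; gcongr
    have h6 : 0 ≤ (‖ζ y‖ * ‖w‖) * (‖ζ y‖ * ‖w‖) := by positivity
    nlinarith
  -- the two points on that line at distance `ε * ‖w‖` from the crossing, one on each side
  obtain ⟨u, hu, hua⟩ := exists_stereo_eq b (q - ε * w)
  obtain ⟨v, hv, hvc⟩ := exists_stereo_eq b (q + ε * w)
  have hζ_ends : ∀ y : S1, ∀ δ : ℝ, |δ| = ε → ζ y ≠ δ ∨ height b (D.curve y) = 1 := by
    intro y δ hδ
    by_contra! hcon
    have h0 : ζ y ≠ 0 := by
      rw [hcon.1]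
      rintro h
      rw [Complex.ofReal_eq_zero] at h
      rw [h, abs_zero] at hδ
      exact hε.ne hδ
    rcases hstar y hcon.2 (by simp [hcon.1]) (by simp [hcon.1, hδ]) with h | h
    · exact h0 (h ▸ hζs)
    · exact h0 (h ▸ hζt)
  have hu' : u ∉ D.image := by
    rintro ⟨y, rfl⟩
    refine (hζ_ends y (-ε) (by rw [abs_neg, abs_of_pos hε])).elim (fun h => h ?_) hu
    simp only [ζ, hua]; push_cast; field_simp; ring
  have hv' : v ∉ D.image := by
    rintro ⟨y, rfl⟩
    refine (hζ_ends y ε (abs_of_pos hε)).elim (fun h => h ?_) hv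
    simp only [ζ, hvc]; field_simp; ring
  have hyu : ∀ y, D.curve y ≠ u := fun y h => hu' ⟨y, h⟩
  have hyv : ∀ y, D.curve y ≠ v := fun y h => hv' ⟨y, h⟩
  refine ⟨u, v, hu, hv, hu', hv', ?_⟩
  have hg : ∀ y : S1, height b (D.curve y) ≠ 1 →
      annulusMap b (stereo b u) (stereo b v) (D.curve y) = (ζ y + ε) / (ζ y - ε) := by
    intro y hy
    rw [annulusMap_eq b _ _ hy, hua, hvc, ← mul_div_mul_right (ζ y + ε) (ζ y - ε) hw]
    congr 1 <;> · simp only [ζ]; field_simp; ring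
  have hnear : ∀ r : ℝ, height b (D.curve r) ≠ 1 →
      ∀ᶠ x : ℝ in nhds r, height b (D.curve x) ≠ 1 := fun r hr => by
    have : Continuous fun x : ℝ => height b (D.curve x) :=
      (height b).continuous.comp D.smooth.continuous
    exact this.continuousAt.eventually_ne hr
  have hpole' : height b (D.curve t) ≠ 1 := hcross ▸ hpole
  have hone : ((0 : ℂ) + ε) / (0 - ε) = -1 := by
    have : (ε : ℂ) ≠ 0 := by exact_mod_cast hε.ne'
    field_simp
    ring
  obtain ⟨n, hn⟩ := hasWinding_exists
    (g := fun x => annulusMap b (stereo b u) (stereo b v) (D.curve x))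
    ((continuousOn_annulusMap_right b hu hv).comp_continuous D.continuous_curve hyv)
    (fun y => annulusMap_ne_zero b hu hv (hyu y) (hyv y))
  have h2 := hn.eq_two hst1 hst2 (by rw [hg s hpole, hζs, hone])
    (by rw [hg t hpole', hζt, hone])
    (fun y hys hyt => by
      by_cases hy : height b (D.curve y) = 1
      · rw [annulusMap_pole b _ _ hy]; exact Complex.one_mem_slitPlane
      · rw [hg y hy]
        refine add_div_sub_mem_slitPlane hε fun him => ?_
        by_contra! hle
        exact (hstar y hy him hle).elim hys hyt)
    (crossesDown_of_im_sign (ζ := ζ) hε ((hnear s hpole).mono fun x => hg x) hsign_s)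
    (crossesDown_of_im_sign (ζ := ζ) hε ((hnear t hpole').mono fun x => hg x) hsign_t)
  exact h2 ▸ hn

end frame

/-! ### Invariance under isotopies and Reidemeister moves -/

variable {f : S2 → ℂ} {F : Set S2} {D E : Diagram}

theorem Diagram.exists_hasWinding (hf : ContinuousOn f F) (h0 : ∀ x ∈ F, f x ≠ 0)
    (hD : D.image ⊆ F) : ∃ n, HasWinding (fun x => f (D.curve x)) n :=
  hasWinding_exists (hf.comp_continuous D.continuous_curve fun x => hD ⟨x, rfl⟩)
    fun x => h0 _ (hD ⟨x, rfl⟩)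

theorem IsotopicOn.natAbs_winding_eq (h : IsotopicOn F D E) (hf : ContinuousOn f F)
    (h0 : ∀ x ∈ F, f x ≠ 0) {m n : ℤ} (hm : HasWinding (fun x => f (D.curve x)) m)
    (hn : HasWinding (fun x => f (E.curve x)) n) : m.natAbs = n.natAbs := by
  obtain ⟨hD, -, H, ρ, hρ, -⟩ := h
  have hDF : ∀ x, D.curve x ∈ F := fun x => hD ⟨x, rfl⟩
  have hfF : Continuous fun y : F => f y := hf.domRestrict
  have hc : Continuous fun q : unitInterval × S1 =>
      f (H.map (q.1, ⟨D.curve q.2, hDF q.2⟩) : S2) := by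
    have := D.continuous_curve
    exact hfF.comp (H.map.continuous.comp (by fun_prop))
  have h1 : HasWinding (fun x => f (H.map (1, ⟨D.curve x, hDF x⟩) : S2)) m :=
    HasWinding.of_family isPreconnected_univ
      (G := fun τ x => f (H.map (τ, ⟨D.curve x, hDF x⟩) : S2))
      hc.continuousOn (fun τ _ x => h0 _ (H.map (τ, ⟨D.curve x, hDF x⟩)).2)
      (Set.mem_univ 0) (Set.mem_univ 1) (by simpa [H.map_zero] using hm)
  have h2 : HasWinding ((fun x => f (E.curve x)) ∘ ρ) m := by
    convert h1 using 2 with x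
    rw [Function.comp_apply, hρ x (hDF x)]
  refine Int.natAbs_eq_of_dvd_dvd ?_ (hn.dvd_of_comp ρ.continuous h2)
  exact h2.dvd_of_comp ρ.symm.continuous (by simpa [Function.comp_def] using hn)

/-- On a closed disk without zeros of `f` the continuous function `f` has a logarithm. -/
theorem IsDiskPair.exists_log {U Δ : Set S2} (h : IsDiskPair U Δ) (hf : ContinuousOn f Δ)
    (h0 : ∀ x ∈ Δ, f x ≠ 0) :
    ∃ ℓ : S2 → ℂ, ContinuousOn ℓ Δ ∧ ∀ x ∈ Δ, Complex.exp (ℓ x) = f x := by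
  obtain ⟨φ, hφ, hinj, -, hΔ⟩ := h
  -- the radial retraction of the plane onto the closed unit disk
  let r : ℂ → ℂ := fun z => (((max 1 ‖z‖)⁻¹ : ℝ) : ℂ) * z
  have hmax : ∀ z : ℂ, 0 < max 1 ‖z‖ := fun z => lt_max_of_lt_left one_pos
  have hr : Continuous r := by
    have : Continuous fun z : ℂ => (max 1 ‖z‖)⁻¹ :=
      Continuous.inv₀ (by fun_prop) fun z => (hmax z).ne'
    fun_prop
  have hrB : ∀ z, r z ∈ Metric.closedBall (0 : ℂ) 1 := fun z => by
    rw [mem_closedBall_zero_iff, norm_mul, Complex.norm_real,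
      Real.norm_of_nonneg (inv_nonneg.2 (hmax z).le), inv_mul_le_one₀ (hmax z)]
    exact le_max_right _ _
  have hr_id : ∀ z ∈ Metric.closedBall (0 : ℂ) 1, r z = z := fun z hz => by
    rw [mem_closedBall_zero_iff] at hz
    simp [r, max_eq_left hz]
  have hφΔ : ∀ z ∈ Metric.closedBall (0 : ℂ) 1, φ z ∈ Δ := fun z hz => hΔ ▸ ⟨z, hz, rfl⟩
  obtain ⟨L, hL, hLe⟩ := exists_continuous_log (g := fun z => f (φ (r z)))
    (hf.comp_continuous (hφ.comp_continuous hr hrB) fun z => hφΔ _ (hrB z))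
    fun z => h0 _ (hφΔ _ (hrB z))
  have hcomp : CompactSpace (Metric.closedBall (0 : ℂ) 1) :=
    isCompact_iff_compactSpace.1 (isCompact_closedBall 0 1)
  have hemb : Topology.IsClosedEmbedding ((Metric.closedBall (0 : ℂ) 1).domRestrict φ) :=
    hφ.domRestrict.isClosedEmbedding hinj.injective
  have hex : ∀ x : S2, ∃ z : Metric.closedBall (0 : ℂ) 1, x ∈ Δ → φ z = x := fun x => by
    by_cases hx : x ∈ Δ
    · obtain ⟨z, hz, rfl⟩ := hΔ ▸ hx
      exact ⟨⟨z, hz⟩, fun _ => rfl⟩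
    · exact ⟨⟨0, by simp⟩, fun h => absurd h hx⟩
  choose ψ hψ using hex
  have hψc : ContinuousOn ψ Δ := by
    rw [hemb.isInducing.continuousOn_iff]
    exact continuousOn_id.congr hψ
  refine ⟨fun x => L (ψ x), hL.comp_continuousOn (continuous_subtype_val.comp_continuousOn hψc),
    fun x hx => ?_⟩
  rw [hLe, hr_id _ (ψ x).2, hψ x hx]

/-- A modification of a diagram inside a disk in `F` (a Reidemeister move of any type) does not change the winding number, because
`f` has a logarithm on the disk. -/
theorem DifferInDisk.hasWinding {U Δ : Set S2} {k : ℕ} {a b : Fin k → ℝ}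
    (h : DifferInDisk F U Δ a b D E) (hf : ContinuousOn f F) (h0 : ∀ x ∈ F, f x ≠ 0) {n : ℤ}
    (hn : HasWinding (fun x => f (D.curve x)) n) : HasWinding (fun x => f (E.curve x)) n := by
  classical
  obtain ⟨ℓ, hℓ, hℓe⟩ := h.disk.exists_log (hf.mono h.disk_subset)
    fun x hx => h0 x (h.disk_subset hx)
  have hΔclosed : IsClosed Δ := by
    obtain ⟨φ, hφ, -, -, hΔ⟩ := h.disk
    rw [← hΔ]
    exact ((isCompact_closedBall 0 1).image_of_continuousOn hφ).isClosed
  have hUΔ : U ⊆ Δ := by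
    obtain ⟨φ, -, -, hU, hΔ⟩ := h.disk
    rw [← hU, ← hΔ]
    exact Set.image_mono Metric.ball_subset_closedBall
  have hiff : ∀ x, D.curve x ∈ Δ ↔ E.curve x ∈ Δ := fun x =>
    (h.left_arcs.1 x).trans (h.right_arcs.1 x).symm
  let K₁ : Set S1 := {x | D.curve x ∈ Δ}
  let K₂ : Set S1 := {x | D.curve x ∉ U}
  have hK₁ : IsClosed K₁ := hΔclosed.preimage D.continuous_curve
  have hK₂ : IsClosed K₂ := by
    have : K₂ = (⋃ j, openArc (a j) (b j))ᶜ := by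
      ext x
      simp [K₂, h.left_arcs.2.1 x]
    rw [this, isClosed_compl_iff]
    exact isOpen_iUnion fun j => QuotientAddGroup.isOpenMap_coe _ isOpen_Ioo
  have heq : ∀ x ∈ K₂, D.curve x = E.curve x := fun x hx =>
    h.curve_eq x fun j hj => hx ((h.left_arcs.2.1 x).2 ⟨j, hj⟩)
  let c : S1 → ℂ := fun x => if D.curve x ∈ Δ then ℓ (E.curve x) - ℓ (D.curve x) else 0
  have hc₁ : ContinuousOn c K₁ := by
    refine ContinuousOn.congr (f := fun x => ℓ (E.curve x) - ℓ (D.curve x)) ?_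
      fun x hx => if_pos hx
    exact (hℓ.comp E.continuous_curve.continuousOn fun x hx => (hiff x).1 hx).sub
      (hℓ.comp D.continuous_curve.continuousOn fun x hx => hx)
  have hc₂ : ContinuousOn c K₂ := by
    refine ContinuousOn.congr (f := fun _ => (0 : ℂ)) continuousOn_const fun x hx => ?_
    simp [c, heq x hx]
  have hc : Continuous c := by
    rw [← continuousOn_univ]
    refine (hc₁.union_of_isClosed hc₂ hK₁ hK₂).mono fun x _ => ?_
    by_cases hx : D.curve x ∈ U
    · exact Or.inl (hUΔ hx)
    · exact Or.inr hx
  refine hn.exp_mul hc fun x => ?_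
  by_cases hx : D.curve x ∈ Δ
  · simp only [c, if_pos hx]
    rw [Complex.exp_sub, hℓe _ hx, hℓe _ ((hiff x).1 hx),
      div_mul_cancel₀ _ (h0 _ (h.disk_subset hx))]
  · have : x ∈ K₂ := fun hU => hx (hUΔ hU)
    simp [c, if_neg hx, heq x this]

theorem Step.exists_natAbs_winding_iff (h : Step F D E) (hf : ContinuousOn f F)
    (h0 : ∀ x ∈ F, f x ≠ 0) (k : ℕ) :
    (∃ n : ℤ, HasWinding (fun x => f (D.curve x)) n ∧ n.natAbs = k) ↔
      ∃ n : ℤ, HasWinding (fun x => f (E.curve x)) n ∧ n.natAbs = k := by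
  suffices ∃ m n : ℤ, HasWinding (fun x => f (D.curve x)) m ∧
      HasWinding (fun x => f (E.curve x)) n ∧ m.natAbs = n.natAbs by
    obtain ⟨m, n, hm, hn, hmn⟩ := this
    constructor
    · rintro ⟨i, hi, rfl⟩
      exact ⟨n, hn, by rw [hi.unique hm, hmn]⟩
    · rintro ⟨i, hi, rfl⟩
      exact ⟨m, hm, by rw [hi.unique hn, hmn]⟩
  have key : ∀ {U Δ : Set S2} {k : ℕ} {a b : Fin k → ℝ}, DifferInDisk F U Δ a b D E →
      ∃ m n : ℤ, HasWinding (fun x => f (D.curve x)) m ∧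
        HasWinding (fun x => f (E.curve x)) n ∧ m.natAbs = n.natAbs := fun hd => by
    obtain ⟨m, hm⟩ := Diagram.exists_hasWinding hf h0 hd.left_subset
    exact ⟨m, m, hm, hd.hasWinding hf h0 hm, rfl⟩
  rcases h with h | ⟨_, _, _, _, h, -⟩ | ⟨_, _, _, _, h, -⟩ | ⟨_, _, _, _, h, -⟩
  · obtain ⟨m, hm⟩ := Diagram.exists_hasWinding hf h0 h.1
    obtain ⟨n, hn⟩ := Diagram.exists_hasWinding hf h0 h.2.1
    exact ⟨m, n, hm, hn, h.natAbs_winding_eq hf h0 hm hn⟩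
  all_goals exact key h

/-- The absolute value of the winding number is an invariant of diagrams on `F`. -/
theorem ReidemeisterEquivalent.exists_natAbs_winding_iff (h : ReidemeisterEquivalent F D E)
    (hf : ContinuousOn f F) (h0 : ∀ x ∈ F, f x ≠ 0) (k : ℕ) :
    (∃ n : ℤ, HasWinding (fun x => f (D.curve x)) n ∧ n.natAbs = k) ↔
      ∃ n : ℤ, HasWinding (fun x => f (E.curve x)) n ∧ n.natAbs = k := by
  induction h with
  | rel _ _ h => exact h.exists_natAbs_winding_iff hf h0 k
  | refl => exact Iff.rfl
  | symm _ _ _ ih => exact ih.symm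
  | trans _ _ _ _ _ ih₁ ih₂ => exact ih₁.trans ih₂

/-! ### The two regions -/

theorem Diagram.curve_injective_of_crossingNumber_eq_zero (h : D.crossingNumber = 0) :
    Function.Injective D.curve := fun s t hst => by
  by_contra hne
  have h1 : D.crossings = ∅ := (Set.ncard_eq_zero D.finite_crossings).1 h
  exact h1.subset (show D.curve t ∈ D.crossings from ⟨s, t, hne, hst, rfl⟩)

theorem exists_frame (q : S2) : ∃ b : OrthonormalBasis (Fin 3) ℝ E3, b 2 = q := by
  have h : Orthonormal ℝ (({2} : Set (Fin 3)).domRestrict fun _ => (q : E3)) :=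
    ⟨fun _ => norm_eq_of_mem_sphere q, fun i j hij => absurd (Subsingleton.elim i j) hij⟩
  obtain ⟨b, hb⟩ := h.exists_orthonormalBasis_extension_of_card_eq (by simp)
  exact ⟨b, hb 2 rfl⟩

theorem hasWinding_one : HasWinding (fun _ => 1) 0 :=
  ⟨fun _ => 0, continuous_const, by simp, by simp⟩

/-- The two components of the complement of a diagram in opposite corners of a crossing: the
diagram winds twice around the annulus between any two points of them. -/
theorem Diagram.exists_components (hC : 0 < D.crossingNumber) :
    ∃ (b : OrthonormalBasis (Fin 3) ℝ E3), ∃ c₁ ∈ components D.imageᶜ, ∃ c₂ ∈ components D.imageᶜ,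
      ∀ u ∈ c₁, ∀ v ∈ c₂, u ∉ D.image ∧ v ∉ D.image ∧ height b u ≠ 1 ∧ height b v ≠ 1 ∧
        HasWinding (fun x => annulusMap b (stereo b u) (stereo b v) (D.curve x)) 2 := by
  obtain ⟨p, s, t, hst, hs, ht⟩ := Set.nonempty_of_ncard_ne_zero hC.ne'
  obtain ⟨s, rfl⟩ := QuotientAddGroup.mk_surjective s
  obtain ⟨t, rfl⟩ := QuotientAddGroup.mk_surjective t
  -- the pole is chosen on the curve, so that no region contains it
  have : Infinite (Set.Ico (0 : ℝ) (0 + 1)) :=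
    Set.infinite_coe_iff.2 (Set.Ico_infinite (by norm_num))
  have : Infinite S1 := Infinite.of_injective _ (AddCircle.equivIco (1 : ℝ) 0).symm.injective
  obtain ⟨r, hr⟩ : ∃ r : S1, r ∉ ({(s : S1), (t : S1)} : Set S1) :=
    (Set.toFinite _).exists_notMem
  obtain ⟨b, hb⟩ := exists_frame (D.curve r)
  have hpole : ∀ x ∉ D.image, height b x ≠ 1 := fun x hx h =>
    hx ⟨r, Subtype.ext (hb.symm.trans ((height_eq_one_iff b).1 h).symm)⟩
  have hps : height b (D.curve s) ≠ 1 := fun h => by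
    have h1 : D.curve s = D.curve r := Subtype.ext (((height_eq_one_iff b).1 h).trans hb)
    simp only [Set.mem_insert_iff, Set.mem_singleton_iff, not_or] at hr
    exact D.no_triple s t r hst (Ne.symm hr.2) (Ne.symm hr.1) (hs.trans ht.symm)
      (ht.trans (hs.symm.trans h1))
  obtain ⟨u, v, -, -, hu, hv, huv⟩ := D.exists_hasWinding_two b hst (hs.trans ht.symm) hps
  refine ⟨b, connectedComponentIn D.imageᶜ u, ⟨u, hu, rfl⟩, connectedComponentIn D.imageᶜ v,
    ⟨v, hv, rfl⟩, fun u' hu' v' hv' => ?_⟩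
  have h₁ := connectedComponentIn_subset D.imageᶜ u
  have h₂ := connectedComponentIn_subset D.imageᶜ v
  refine ⟨h₁ hu', h₂ hv', hpole _ (h₁ hu'), hpole _ (h₂ hv'), ?_⟩
  have hne : ∀ {y : S2}, y ∉ D.image → ∀ x, D.curve x ≠ y := fun hy x h => hy ⟨x, h⟩
  have hcurve := D.continuous_curve
  exact HasWinding.of_family (T := S2 × S2)
    (isPreconnected_connectedComponentIn.prod isPreconnected_connectedComponentIn)
    (G := fun q x => annulusMap b (stereo b q.1) (stereo b q.2) (D.curve x))
    ((continuousOn_annulusMap b).comp (f := fun q : (S2 × S2) × S1 => (q.1, D.curve q.2))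
      (by fun_prop) fun q hq => ⟨hpole _ (h₁ hq.1.1), hpole _ (h₂ hq.1.2), hne (h₂ hq.1.2) _⟩)
    (fun q hq x => annulusMap_ne_zero b (hpole _ (h₁ hq.1)) (hpole _ (h₂ hq.2))
      (hne (h₁ hq.1) x) (hne (h₂ hq.2) x))
    (σ := (u, v)) ⟨mem_connectedComponentIn hu, mem_connectedComponentIn hv⟩
    (τ := (u', v')) ⟨hu', hv'⟩ huv

theorem image_subset_puncturedSphere {N : Set S2} (hN : IsRegularNeighbourhood N D.image)
    {S : Set (Set S2)} (hS : S ⊆ regions N) : D.image ⊆ puncturedSphere S := by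
  rintro x hx ⟨R, hR, hxR⟩
  obtain ⟨y, -, rfl⟩ := hS hR
  exact connectedComponentIn_subset _ _ hxR (interior_subset (hN.subset_interior hx))

/-- This bounds the set of numbers of which `cMax` is the supremum, so that the supremum is not a
junk value. -/
theorem minCrossings_le {N : Set S2} (hN : IsRegularNeighbourhood N D.image)
    {S : Set (Set S2)} (hS : S ⊆ regions N) : minCrossings D S ≤ D.crossingNumber :=
  Nat.sInf_le ⟨D, image_subset_puncturedSphere hN hS, Relation.EqvGen.refl D, rfl⟩

theorem cMax_two_pos (hC : 0 < D.crossingNumber) {N : Set S2}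
    (hN : IsRegularNeighbourhood N D.image) : 0 < cMax D N 2 := by
  obtain ⟨b, c₁, hc₁, c₂, hc₂, hwind⟩ := Diagram.exists_components hC
  obtain ⟨U, ⟨hU, hUc⟩, -⟩ := hN.unique_disk c₁ hc₁
  obtain ⟨V, ⟨hV, hVc⟩, -⟩ := hN.unique_disk c₂ hc₂
  have hne : ∀ R ∈ components Nᶜ, R.Nonempty := by
    rintro _ ⟨x, hx, rfl⟩
    exact ⟨x, mem_connectedComponentIn hx⟩
  -- the winding number between a point and itself is `0`
  have hdisj : ∀ u ∈ c₁, u ∉ c₂ := fun u hu₁ hu₂ => by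
    obtain ⟨hu, -, hpole, -, h2⟩ := hwind u hu₁ u hu₂
    have h1 : (fun x => annulusMap b (stereo b u) (stereo b u) (D.curve x)) = fun _ => 1 := by
      funext x
      exact div_self (annulusNum_self_ne_zero b hpole fun h => hu ⟨x, h⟩)
    rw [h1] at h2
    exact absurd (h2.unique hasWinding_one) two_ne_zero
  obtain ⟨u, hu⟩ := hne U hU
  obtain ⟨v, hv⟩ := hne V hV
  have hUV : U ≠ V := by
    rintro rfl
    exact hdisj u (hUc hu) (hVc hu)
  obtain ⟨-, -, hup, hvp, h2⟩ := hwind u (hUc hu) v (hVc hv)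
  have huv : u ≠ v := fun h => hdisj u (hUc hu) (h ▸ hVc hv)
  have hS : ({U, V} : Set (Set S2)) ⊆ regions N := by
    rintro R (rfl | rfl)
    exacts [hU, hV]
  have hFu : ∀ x ∈ puncturedSphere {U, V}, x ≠ u := by
    rintro _ hx rfl
    exact hx ⟨U, Or.inl rfl, hu⟩
  have hFv : ∀ x ∈ puncturedSphere {U, V}, x ≠ v := by
    rintro _ hx rfl
    exact hx ⟨V, Or.inr rfl, hv⟩
  have hpos : 0 < minCrossings D {U, V} := by
    obtain ⟨E, hE, hDE, hEm⟩ := Nat.sInf_mem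
      (s := {m | ∃ E : Diagram, E.image ⊆ puncturedSphere {U, V} ∧
        ReidemeisterEquivalent (puncturedSphere {U, V}) D E ∧ m = E.crossingNumber})
      ⟨_, D, image_subset_puncturedSphere hN hS, Relation.EqvGen.refl D, rfl⟩
    rw [minCrossings, hEm, Nat.pos_iff_ne_zero]
    intro hE0
    obtain ⟨n, hn, hn2⟩ := (hDE.exists_natAbs_winding_iff
      (f := fun x => annulusMap b (stereo b u) (stereo b v) x)
      ((continuousOn_annulusMap_right b hup hvp).mono hFv)
      (fun x hx => annulusMap_ne_zero b hup hvp (hFu x hx) (hFv x hx)) 2).1 ⟨2, h2, rfl⟩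
    have hcoord : ∀ x, height b (E.curve x) ≠ 1 → stereo b (E.curve x) ≠ stereo b v :=
      fun x hx h => hFv _ (hE ⟨x, rfl⟩) (stereo_injective b hx hvp h)
    have := hn.natAbs_le_one fun x y hxy =>
      Diagram.curve_injective_of_crossingNumber_eq_zero hE0
        (annulusMap_injective b (fun h => huv (stereo_injective b hup hvp h))
          (hcoord x) (hcoord y) hxy)
    omega
  refine hpos.trans_le (le_csSup ⟨D.crossingNumber, ?_⟩
    ⟨{U, V}, hS, by simpa using Set.encard_pair hUV, rfl⟩)
  rintro _ ⟨S, hS', -, rfl⟩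
  exact minCrossings_le hN hS'

end PuncturedKnot

theorem theorem1p6 (D : PuncturedKnot.Diagram)
    (htrivial : ∃ K : PuncturedKnot.Knot, D.IsDiagramOf K ∧ K.IsTrivial)
    (hC : 0 < D.crossingNumber)
    (N : Set PuncturedKnot.S2)
    (hN : PuncturedKnot.IsRegularNeighbourhood N D.image) :
    0 < PuncturedKnot.cMax D N 2 :=
  PuncturedKnot.cMax_two_pos hC hN
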